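/- Let $(A,P,\Pi,P^\vee,\Pi^\vee)$ be a Cartan datum: $A=(a_{ij})_{i,j\in I}$ is a generalized Cartan matrix symmetrized by positive integers $d_i$ ($d_ia_{ij}=d_ja_{ji}$), $P$ is a free abelian group of finite rank with dual $P^\vee$, the simple roots $\alpha_i\in P$ are linearly independent, the simple coroots $\alpha_i^\vee\in P^\vee$ satisfy $\langle\alpha_i^\vee,\alpha_j\rangle=a_{ij}$, and fundamental weights exist in $P$. Put $(\alpha_i,\alpha_j)=d_ia_{ij}$. Let $\mathbf k=\bigoplus_{m\ge 0}\mathbf k_m$ be a commutative graded ring (for instance, a domain). Let $Q_{ij}(u,v)\in\mathbf k[u,v]$ $(i,j\in I)$ satisfy $Q_{ij}(u,v)=Q_{ji}(v,u)$, $Q_{ii}=0$, and, for $i\neq j$, $Q_{ij}(u,v)=\sum_{p,q\ge0}c_{i,j,p,q}u^pv^q$ with $c_{i,j,p,q}\in\mathbf k_{-2(\alpha_i,\alpha_j)-(\alpha_i,\alpha_i)p-(\alpha_j,\alpha_j)q}$ (where $\mathbf k_m=0$ for $m<0$) and $c_{i,j,-a_{ij},0}$ invertible. Let $\Lambda\in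 P$ be dominant integral, and for each $i\in I$ let $a_i^\Lambda(u)\in\mathbf k[u]$ be monic of degree $N_i=\langle\alpha_i^\vee,\Lambda\rangle$ whose coefficient of $u^{N_i-r}$ lies in $\mathbf k_{r(\alpha_i,\alpha_i)}$ for $0\le r\le N_i$. Let $\beta=\alpha_{i_1}+\cdots+\alpha_{i_n}$ with $n\ge0$ and $i_1,\dots,i_n\in I$ pairwise distinct. Let $I^\beta=\{\nu\in I^n:\alpha_{\nu_1}+\cdots+\alpha_{\nu_n}=\beta\}$, on which $\mathfrak S_n$ acts by $w.\nu=(\nu_{w^{-1}(1)},\dots,\nu_{w^{-1}(n)})$. Let $R_\beta$ be the Khovanov–Lauda–Rouquier $\mathbf k$-algebra with generators $e(\nu)$ $(\nu\in I^\beta)$, $x_1,\dots,x_n$, $\tau_1,\dots,\tau_{n-1}$ and the following relations (the defining ones for $(Q_{ij})$; no entry of $\nu\in I^\beta$ is repeated, so the correction terms for equal entries do not occur), for all admissible indices: $$e(\nu)e(\nu')=\delta_{\nu,\nu'}e(\nu),\quad \textstyle\sum_{\nu\in I^\beta}e(\nu)=1,\quad x_kx_l=x_lx_k,\quad x_ke(\nu)=e(\nu)x_k,\quad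 \tau_le(\nu)=e(s_l.\nu)\tau_l,$$ $$\tau_k\tau_l=\tau_l\tau_k\ (|k-l|>1),\quad \tau_k^2e(\nu)=Q_{\nu_k,\nu_{k+1}}(x_k,x_{k+1})e(\nu),\quad \tau_kx_l=x_{s_k(l)}\tau_k,\quad \tau_{k+1}\tau_k\tau_{k+1}=\tau_k\tau_{k+1}\tau_k,$$ where $s_k=(k,k+1)$. Let $I_{\Lambda,\beta}$ be the two-sided ideal of $R_\beta$ generated by $\sum_{\nu\in I^\beta}a^\Lambda_{\nu_1}(x_1)e(\nu)$ (the zero ideal if $n=0$), and let $R_\beta^\Lambda=R_\beta/I_{\Lambda,\beta}$. For every $w\in\mathfrak S_n$ choose a reduced decomposition $w=s_{j_1}\cdots s_{j_r}$ and put $\tau_w=\tau_{j_1}\cdots\tau_{j_r}$. For $w\in\mathfrak S_n$, $\nu\in I^\beta$ and $1\le t\le n$ put $$N_{w,\nu,t}=\langle\alpha_{\nu_t}^\vee,\Lambda\rangle-\sum_{1\le k<t,\ w(k)<w(t)}a_{\nu_t,\nu_k}.$$ For $\tilde\nu\in I^\beta$ write $\tilde\nu_s\prec\tilde\nu_t$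 if $s<t$, and define polynomials $g^{\tilde\nu}_{\nu,k}\in\mathbf k[x_1,\dots,x_n]$ $(\nu\in I^\beta,\ 1\le k\le n)$ by $g^{\tilde\nu}_{\nu,1}=a^\Lambda_{\nu_1}(x_1)$ and, for $1\le k<n$, $$g^{\tilde\nu}_{\nu,k+1}=\begin{cases}s_k\bigl(g^{\tilde\nu}_{s_k.\nu,k}\bigr)&\text{if }\nu_k\succ\nu_{k+1},\\ s_k\bigl(g^{\tilde\nu}_{s_k.\nu,k}\bigr)\,Q_{\nu_k,\nu_{k+1}}(x_k,x_{k+1})&\text{if }\nu_k\prec\nu_{k+1},\end{cases}$$ where $s_k$ acts on polynomials by exchanging $x_k$ and $x_{k+1}$. Put $g^\Lambda_{w,\nu,k}=g^{w.\nu}_{\nu,k}$. Then: (1) $R_\beta^\Lambda$ is a free $\mathbf k$-module, with basis the images of the elements $\tau_w\,x_1^{a_1}\cdots x_n^{a_n}\,e(\nu)$, where $\nu\in I^\beta$, $w\in\mathfrak S_n$ and $(a_1,\dots,a_n)\in\mathbb N^n$ satisfy $a_t<N_{w,\nu,t}$ for all $1\le t\le n$. (2) $I_{\Lambda,\beta}$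 is a free $\mathbf k$-module, with basis the elements $\tau_w\,x_1^{a_1}\cdots x_n^{a_n}\,g^\Lambda_{w,\nu,k}\,e(\nu)$, where $\nu\in I^\beta$, $w\in\mathfrak S_n$, $1\le k\le n$ and $(a_1,\dots,a_n)\in\mathbb N^n$ satisfy $a_t<N_{w,\nu,t}$ for all $k<t\le n$. -/

import Mathlib

namespace KLRAlg

/-- A Cartan datum with index set `I` and weight lattice `P`: a generalized Cartan matrix `a`
together with a symmetrizer `d`, simple roots in `P`, and simple coroots in `P^∨ = Hom(P, ℤ)`.
(`P` is required to be free of finite rank where the datum is used.) -/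
structure CartanDatum (I : Type*) (P : Type*) [AddCommGroup P] where
  a : I → I → ℤ
  d : I → ℤ
  a_diag : ∀ i, a i i = 2
  a_nonpos : ∀ i j, i ≠ j → a i j ≤ 0
  a_zero_iff : ∀ i j, a i j = 0 ↔ a j i = 0
  d_pos : ∀ i, 0 < d i
  d_symm : ∀ i j, d i * a i j = d j * a j i
  root : I → P
  coroot : I → Module.Dual ℤ P
  coroot_root : ∀ i j, coroot i (root j) = a i j
  root_linearIndependent : LinearIndependent ℤ root
  exists_fundamental : ∀ i, ∃ ϖ : P, coroot i ϖ = 1 ∧ ∀ j, j ≠ i → coroot j ϖ = 0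

namespace CartanDatum

variable {I P : Type*} [AddCommGroup P] (D : CartanDatum I P)

/-- The value `(α_i, α_j) = d_i a_{ij}` of the invariant form on simple roots. -/
def form (i j : I) : ℤ := D.d i * D.a i j

/-- Membership in `P⁺`. -/
def IsDominant (L : P) : Prop := ∀ i, 0 ≤ D.coroot i L

end CartanDatum

/-- The homogeneous component of integral degree `m` of an `ℕ`-graded ring; it is zero for
negative `m`. -/
def piece {k : Type*} [CommRing k] (A : ℕ → AddSubgroup k) (m : ℤ) : AddSubgroup k :=
  if 0 ≤ m then A m.toNat else ⊥

/-- The coefficient of `u^p v^q` of a polynomial in `k[u,v]`, where `u`, `v` are the variables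
number `0` and `1`. -/
noncomputable def coeffUV {k : Type*} [CommRing k] (f : MvPolynomial (Fin 2) k) (p q : ℕ) : k :=
  f.coeff (Finsupp.single 0 p + Finsupp.single 1 q)

/-- A matrix `(Q_{ij})` in `k[u,v]` as in the definition of the Khovanov-Lauda-Rouquier algebras.
The coefficient of `u^{-a_{ij}}` has degree `0`, and an element of degree `0` is a unit of `k` if
and only if it is a unit of the degree `0` part. -/
structure QMatrix {I P k : Type*} [AddCommGroup P] [CommRing k] (D : CartanDatum I P)
    (A : ℕ → AddSubgroup k) where
  Q : I → I → MvPolynomial (Fin 2) k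
  symm : ∀ i j, Q i j = MvPolynomial.rename (Equiv.swap (0 : Fin 2) 1) (Q j i)
  diag : ∀ i, Q i i = 0
  homogeneous : ∀ i j, i ≠ j → ∀ p q : ℕ,
    coeffUV (Q i j) p q ∈ piece A (-2 * D.form i j - D.form i i * p - D.form j j * q)
  isUnit_coeff : ∀ i j, i ≠ j → IsUnit (coeffUV (Q i j) (-D.a i j).toNat 0)

/-- A choice, for every `i`, of a monic polynomial `a_i^Λ(u)` of degree `N = ⟨α_i^∨, Λ⟩` whose
coefficient of `u^{N - r}` has degree `r (α_i, α_i)`. -/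
structure CyclotomicPolys {I P k : Type*} [AddCommGroup P] [CommRing k] (D : CartanDatum I P)
    (A : ℕ → AddSubgroup k) (L : P) where
  poly : I → Polynomial k
  monic : ∀ i, (poly i).Monic
  natDegree_eq : ∀ i, ((poly i).natDegree : ℤ) = D.coroot i L
  homogeneous : ∀ i, ∀ r : ℕ, r ≤ (poly i).natDegree →
    (poly i).coeff ((poly i).natDegree - r) ∈ piece A (r * D.form i i)

section Perm

variable {n : ℕ}

/-- The strand `l`, for `l` in the index set of the simple transpositions of `S_n`. -/
def lo (l : Fin (n - 1)) : Fin n := ⟨l.1, by omega⟩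

/-- The strand `l + 1`. -/
def hi (l : Fin (n - 1)) : Fin n := ⟨l.1 + 1, by omega⟩

/-- The simple transposition `s_l = (l, l+1)`. -/
def simple (l : Fin (n - 1)) : Equiv.Perm (Fin n) := Equiv.swap (lo l) (hi l)

/-- `word = (i_1, …, i_r)` is a reduced decomposition `w = s_{i_1} ⋯ s_{i_r}`. -/
def IsReducedWord (word : List (Fin (n - 1))) (w : Equiv.Perm (Fin n)) : Prop :=
  (word.map simple).prod = w ∧
    ∀ word' : List (Fin (n - 1)), (word'.map simple).prod = w → word.length ≤ word'.length

end Perm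

section Poly

variable {k : Type*} [CommRing k] {n : ℕ}

/-- The ordered monomial `x_1^{a_1} ⋯ x_n^{a_n}` in elements `x_1, …, x_n` of a ring. -/
def monom {R : Type*} [Ring R] (x : Fin n → R) (a : Fin n → ℕ) : R :=
  (List.ofFn fun t => x t ^ a t).prod

/-- The value `f(x_1, …, x_n)` of a polynomial at elements of a `k`-algebra; it is used for
elements that commute, or that commute modulo the relations at hand. -/
noncomputable def evalAt {R : Type*} [Ring R] [Algebra k R] (x : Fin n → R)
    (f : MvPolynomial (Fin n) k) : R :=
  ∑ m ∈ f.support, f.coeff m • monom x m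

theorem evalAt_eq_aeval {R : Type*} [CommRing R] [Algebra k R] (x : Fin n → R)
    (f : MvPolynomial (Fin n) k) : evalAt x f = MvPolynomial.aeval x f := by
  rw [MvPolynomial.aeval_def, MvPolynomial.eval₂_eq']
  simp [evalAt, monom, List.prod_ofFn, Algebra.smul_def]

theorem exists_divDiff (s t : Fin n) (f : MvPolynomial (Fin n) k) :
    ∃ h : MvPolynomial (Fin n) k,
      (MvPolynomial.X s - MvPolynomial.X t) * h = f - MvPolynomial.rename (Equiv.swap s t) f := by
  induction f using MvPolynomial.induction_on with
  | C c => exact ⟨0, by simp⟩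
  | add f g hf hg =>
    obtain ⟨a, ha⟩ := hf
    obtain ⟨b, hb⟩ := hg
    exact ⟨a + b, by rw [mul_add, ha, hb, map_add]; ring⟩
  | mul_X f i hf =>
    obtain ⟨a, ha⟩ := hf
    have key : ∃ c : MvPolynomial (Fin n) k, (MvPolynomial.X s - MvPolynomial.X t) * c =
        MvPolynomial.X i - MvPolynomial.X (Equiv.swap s t i) := by
      by_cases h1 : i = s
      · exact ⟨1, by simp [h1]⟩
      · by_cases h2 : i = t
        · exact ⟨-1, by simp [h2]⟩
        · exact ⟨0, by simp [Equiv.swap_apply_of_ne_of_ne h1 h2]⟩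
    obtain ⟨c, hc⟩ := key
    refine ⟨a * MvPolynomial.X i + MvPolynomial.rename (Equiv.swap s t) f * c, ?_⟩
    rw [map_mul, MvPolynomial.rename_X]
    linear_combination MvPolynomial.X i * ha + MvPolynomial.rename (Equiv.swap s t) f * hc

/-- The divided difference `(f - (s t) f) / (x_s - x_t)`, where the transposition `(s t)` acts by
exchanging the variables `x_s` and `x_t`. -/
noncomputable def divDiff (s t : Fin n) (f : MvPolynomial (Fin n) k) : MvPolynomial (Fin n) k :=
  (exists_divDiff s t f).choose

theorem divDiff_spec (s t : Fin n) (f : MvPolynomial (Fin n) k) :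
    (MvPolynomial.X s - MvPolynomial.X t) * divDiff s t f =
      f - MvPolynomial.rename (Equiv.swap s t) f :=
  (exists_divDiff s t f).choose_spec

end Poly

section Algebra

variable {I P k : Type*} [AddCommGroup P] [CommRing k]

/-- The set `I^β ⊆ I^n` of sequences `ν` with `α_{ν_1} + ⋯ + α_{ν_n} = β`, i.e. the `S_n`-orbit
in `I^n` that corresponds to `β`. -/
def Weight (D : CartanDatum I P) (n : ℕ) (β : P) : Type _ :=
  {ν : Fin n → I // ∑ t, D.root (ν t) = β}

instance (D : CartanDatum I P) [Module.Finite ℤ P] (n : ℕ) (β : P) : Finite (Weight D n β) :=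
  haveI : Finite I := D.root_linearIndependent.finite
  inferInstanceAs (Finite {ν : Fin n → I // ∑ t, D.root (ν t) = β})

noncomputable instance (D : CartanDatum I P) [Module.Finite ℤ P] (n : ℕ) (β : P) :
    Fintype (Weight D n β) := Fintype.ofFinite _

/-- The action `w.ν = (ν_{w⁻¹(1)}, …, ν_{w⁻¹(n)})`. -/
def Weight.act {D : CartanDatum I P} {n : ℕ} {β : P} (w : Equiv.Perm (Fin n))
    (ν : Weight D n β) : Weight D n β :=
  ⟨fun t => ν.1 (w⁻¹ t), (Equiv.sum_comp (w⁻¹) fun t => D.root (ν.1 t)).trans ν.2⟩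

/-- The generators `e(ν)`, `x_t`, `τ_l`. -/
inductive Gen (D : CartanDatum I P) (n : ℕ) (β : P)
  | e (ν : Weight D n β)
  | x (t : Fin n)
  | tau (l : Fin (n - 1))

variable {D : CartanDatum I P} {A : ℕ → AddSubgroup k}

/-- `Q_{ij}(x_s, x_t)` as a polynomial in `x_1, …, x_n`. -/
noncomputable def QMatrix.at (Q : QMatrix D A) {n : ℕ} (i j : I) (s t : Fin n) :
    MvPolynomial (Fin n) k :=
  MvPolynomial.aeval ![MvPolynomial.X s, MvPolynomial.X t] (Q.Q i j)

namespace Free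

variable (k) {n : ℕ} {β : P}

/-- `e(ν)` in the free algebra. -/
def e (ν : Weight D n β) : FreeAlgebra k (Gen D n β) := FreeAlgebra.ι k (Gen.e ν)

/-- `x_t` in the free algebra. -/
def x (t : Fin n) : FreeAlgebra k (Gen D n β) := FreeAlgebra.ι k (Gen.x t)

/-- `τ_l` in the free algebra. -/
def tau (l : Fin (n - 1)) : FreeAlgebra k (Gen D n β) := FreeAlgebra.ι k (Gen.tau l)

end Free

open Free in
/-- The defining relations of the Khovanov-Lauda-Rouquier algebra. In the last two, `l' = l + 1`,
and the correction term is
`(Q_{ν_l,ν_{l+1}}(x_l, x_{l+1}) - Q_{ν_{l+2},ν_{l+1}}(x_{l+2}, x_{l+1})) / (x_l - x_{l+2})`. -/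
inductive Rel [Module.Finite ℤ P] (Q : QMatrix D A) (n : ℕ) (β : P) :
    FreeAlgebra k (Gen D n β) → FreeAlgebra k (Gen D n β) → Prop
  | e_mul_self (ν : Weight D n β) : Rel Q n β (e k ν * e k ν) (e k ν)
  | e_mul_ne (ν ν' : Weight D n β) (h : ν ≠ ν') : Rel Q n β (e k ν * e k ν') 0
  | sum_e : Rel Q n β (∑ ν : Weight D n β, e k ν) 1
  | x_comm (s t : Fin n) : Rel Q n β (x k s * x k t) (x k t * x k s)
  | x_e (t : Fin n) (ν : Weight D n β) : Rel Q n β (x k t * e k ν) (e k ν * x k t)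
  | tau_e (l : Fin (n - 1)) (ν : Weight D n β) :
      Rel Q n β (tau k l * e k ν) (e k (ν.act (simple l)) * tau k l)
  | tau_comm (l m : Fin (n - 1)) (h : l.1 + 1 < m.1 ∨ m.1 + 1 < l.1) :
      Rel Q n β (tau k l * tau k m) (tau k m * tau k l)
  | tau_sq (l : Fin (n - 1)) (ν : Weight D n β) :
      Rel Q n β (tau k l * tau k l * e k ν)
        (evalAt (x k) (Q.at (ν.1 (lo l)) (ν.1 (hi l)) (lo l) (hi l)) * e k ν)
  | tau_x_lo (l : Fin (n - 1)) (ν : Weight D n β) (h : ν.1 (lo l) = ν.1 (hi l)) :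
      Rel Q n β ((tau k l * x k (lo l) - x k (hi l) * tau k l) * e k ν) (-e k ν)
  | tau_x_hi (l : Fin (n - 1)) (ν : Weight D n β) (h : ν.1 (lo l) = ν.1 (hi l)) :
      Rel Q n β ((tau k l * x k (hi l) - x k (lo l) * tau k l) * e k ν) (e k ν)
  | tau_x (l : Fin (n - 1)) (t : Fin n) (ν : Weight D n β)
      (h : ¬ ((t = lo l ∨ t = hi l) ∧ ν.1 (lo l) = ν.1 (hi l))) :
      Rel Q n β ((tau k l * x k t - x k (simple l t) * tau k l) * e k ν) 0
  | braid_eq (l l' : Fin (n - 1)) (hl : l'.1 = l.1 + 1) (ν : Weight D n β)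
      (h : ν.1 (lo l) = ν.1 (hi l')) :
      Rel Q n β ((tau k l' * tau k l * tau k l' - tau k l * tau k l' * tau k l) * e k ν)
        (evalAt (x k) (divDiff (lo l) (hi l')
          (Q.at (ν.1 (lo l)) (ν.1 (hi l)) (lo l) (hi l))) * e k ν)
  | braid_ne (l l' : Fin (n - 1)) (hl : l'.1 = l.1 + 1) (ν : Weight D n β)
      (h : ν.1 (lo l) ≠ ν.1 (hi l')) :
      Rel Q n β ((tau k l' * tau k l * tau k l' - tau k l * tau k l' * tau k l) * e k ν) 0

/-- The numerator in the braid relation, written out. -/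
theorem braid_numerator (Q : QMatrix D A) {n : ℕ} (l l' : Fin (n - 1)) (hl : l'.1 = l.1 + 1)
    (i j i' : I) (h : i = i') :
    (MvPolynomial.X (lo l) - MvPolynomial.X (hi l')) *
        divDiff (lo l) (hi l') (Q.at i j (lo l) (hi l)) =
      Q.at i j (lo l) (hi l) - Q.at i' j (hi l') (hi l) := by
  subst h
  rw [divDiff_spec]
  congr 1
  have h1 : hi l ≠ lo l := by simp [hi, lo, Fin.ext_iff]
  have h2 : hi l ≠ hi l' := by simp [hi, Fin.ext_iff, hl]
  rw [QMatrix.at, QMatrix.at, ← AlgHom.comp_apply]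
  congr 1
  ext m
  fin_cases m <;> simp [Equiv.swap_apply_of_ne_of_ne h1 h2]

variable [Module.Finite ℤ P]

/-- The Khovanov-Lauda-Rouquier algebra `R_β` over `k`, for `β` of height `n`. -/
def KLR (Q : QMatrix D A) (n : ℕ) (β : P) : Type _ := RingQuot (Rel Q n β)

noncomputable instance (Q : QMatrix D A) (n : ℕ) (β : P) : Ring (KLR Q n β) :=
  inferInstanceAs (Ring (RingQuot (Rel Q n β)))

noncomputable instance (Q : QMatrix D A) (n : ℕ) (β : P) : Algebra k (KLR Q n β) :=
  inferInstanceAs (Algebra k (RingQuot (Rel Q n β)))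

namespace KLR

variable (Q : QMatrix D A) {n : ℕ} {β : P}

/-- The canonical map from the free algebra. -/
noncomputable def mk : FreeAlgebra k (Gen D n β) →ₐ[k] KLR Q n β :=
  RingQuot.mkAlgHom k (Rel Q n β)

/-- `e(ν) ∈ R_β`. -/
noncomputable def e (ν : Weight D n β) : KLR Q n β := mk Q (Free.e k ν)

/-- `x_t ∈ R_β`. -/
noncomputable def x (t : Fin n) : KLR Q n β := mk Q (Free.x k t)

/-- `τ_l ∈ R_β`. -/
noncomputable def tau (l : Fin (n - 1)) : KLR Q n β := mk Q (Free.tau k l)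

/-- `τ_{i_1} ⋯ τ_{i_r} ∈ R_β`. -/
noncomputable def tauWord (word : List (Fin (n - 1))) : KLR Q n β := (word.map (tau Q)).prod

variable {Q} {L : P}

/-- `a^Λ_β(x_t) = ∑_ν a^Λ_{ν_t}(x_t) e(ν)`. -/
noncomputable def cycloElt (Q : QMatrix D A) (a : CyclotomicPolys D A L) (β : P) (t : Fin n) :
    KLR Q n β :=
  ∑ ν : Weight D n β, Polynomial.aeval (x Q t) (a.poly (ν.1 t)) * e Q ν

/-- The two-sided ideal `I_{Λ,β} = R_β a^Λ_β(x_1) R_β`; it is `0` if `n = 0`. -/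
noncomputable def cycloIdeal (Q : QMatrix D A) (a : CyclotomicPolys D A L) (n : ℕ) (β : P) :
    TwoSidedIdeal (KLR Q n β) :=
  TwoSidedIdeal.span {y | ∃ t : Fin n, t.1 = 0 ∧ y = cycloElt Q a β t}

/-- `I_{Λ,β}` as a `k`-module. -/
noncomputable def cycloSubmodule (Q : QMatrix D A) (a : CyclotomicPolys D A L) (n : ℕ) (β : P) :
    Submodule k (KLR Q n β) :=
  (cycloIdeal Q a n β).asIdeal.restrictScalars k

/-- The cyclotomic algebra `R^Λ_β = R_β / I_{Λ,β}`. -/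
abbrev Cyclotomic (Q : QMatrix D A) (a : CyclotomicPolys D A L) (n : ℕ) (β : P) : Type _ :=
  (cycloIdeal Q a n β).ringCon.Quotient

/-- The canonical surjection `R_β → R^Λ_β`. -/
noncomputable def toCyclotomic (Q : QMatrix D A) (a : CyclotomicPolys D A L) (n : ℕ) (β : P) :
    KLR Q n β →+* Cyclotomic Q a n β :=
  (cycloIdeal Q a n β).ringCon.mk'

end KLR

end Algebra

section Bases

variable {I P k : Type*} [AddCommGroup P] [CommRing k] {D : CartanDatum I P}
  {A : ℕ → AddSubgroup k} {L : P}

/-- For `ν̃ ∈ I^n` in which equal entries are adjacent, the order on the entries of `ν̃` by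
their position. -/
def Prec {n : ℕ} (νt : Fin n → I) (i j : I) : Prop :=
  i ≠ j ∧ ∃ s t : Fin n, s < t ∧ νt s = i ∧ νt t = j

open scoped Classical in
/-- The polynomials `g^Λ_{ν,r}` attached to `ν̃` (here `νt`), with `r` counted from `0`:
`g_{ν,0} = a^Λ_{ν_0}(x_0)`, and `g_{ν,r+1}` is
* `∂_r(g_{ν,r}) = (g_{ν,r} - s_r g_{ν,r}) / (x_{r+1} - x_r)` if `ν_r = ν_{r+1}`,
* `s_r(g_{s_r.ν,r})` if `ν_r ≻ ν_{r+1}`,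
* `s_r(g_{s_r.ν,r}) Q_{ν_r,ν_{r+1}}(x_r, x_{r+1})` if `ν_r ≺ ν_{r+1}`. -/
noncomputable def gPoly (Q : QMatrix D A) (a : CyclotomicPolys D A L) {n : ℕ} (νt : Fin n → I) :
    (r : ℕ) → r < n → (Fin n → I) → MvPolynomial (Fin n) k
  | 0, h, ν => Polynomial.aeval (MvPolynomial.X (⟨0, h⟩ : Fin n)) (a.poly (ν ⟨0, h⟩))
  | r + 1, h, ν =>
    let p : Fin n := ⟨r, Nat.lt_of_succ_lt h⟩
    let q : Fin n := ⟨r + 1, h⟩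
    if ν p = ν q then
      divDiff q p (gPoly Q a νt r (Nat.lt_of_succ_lt h) ν)
    else
      let f := MvPolynomial.rename (Equiv.swap p q)
        (gPoly Q a νt r (Nat.lt_of_succ_lt h) (ν ∘ Equiv.swap p q))
      if Prec νt (ν q) (ν p) then f else f * Q.at (ν p) (ν q) p q

/-- `g^Λ_{w,ν,r}`: the polynomial `g^Λ_{ν,r}` attached to `ν̃ = w.ν`. -/
noncomputable def gw (Q : QMatrix D A) (a : CyclotomicPolys D A L) {n : ℕ} {β : P}
    (w : Equiv.Perm (Fin n)) (ν : Weight D n β) (r : Fin n) : MvPolynomial (Fin n) k :=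
  gPoly Q a (ν.act w).1 r.1 r.2 ν.1

/-- The bound `⟨α_{ν_t}^∨, Λ⟩ - ∑_{s < t, w(s) < w(t)} a_{ν_t,ν_s}`. -/
def bound (D : CartanDatum I P) (L : P) {n : ℕ} {β : P} (w : Equiv.Perm (Fin n))
    (ν : Weight D n β) (t : Fin n) : ℤ :=
  D.coroot (ν.1 t) L - ∑ s : Fin n with s < t ∧ w s < w t, D.a (ν.1 t) (ν.1 s)

end Bases

end KLRAlg

/-! Roots are linearly independent and β is a sum of distinct ones, so no weight has a repeated
entry. Hence no correction terms occur: polynomials pass `τ_l` by permuting the variables, and `τ_w`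
does not depend on the reduced word (`tauWord_eq`).

PBW decomposition. The map from families of polynomials `f_{ν,w}` to the sum of the `τ_w f_{ν,w}(x)
e(ν)` is bijective. Surjectivity is `span_stdElt`. For `pbwMap_injective` the algebra acts on
families of polynomials in variables `X_i` indexed by colours. The action is normalized by ν so that
a reduced word carries the delta family at ν to the delta family at `w.ν`; distinct `w` then have
visible, independent effects.

The ideal. The recursion for `g` has the closed form `gProd`: `g_{w,ν,r}` is `a_{ν_r}(x_r)` times
the product of `Q_{ν_s,ν_r}(x_s,x_r)` over the non-inversions `s < r`, `w(s) < w(r)`. Let `J_{w,ν}`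
be the ideal of the polynomial ring generated by these. The sum of all `τ_w J_{w,ν} e(ν)` is
two-sided: a generator `τ_l` either removes a non-inversion, enlarging the ideal, or adds one and
supplies the missing factor `Q`. It contains the cyclotomic generator, and every `τ_w g_{w,ν,r}
e(ν)` arises from that generator by multiplying on the right by successive `τ_l`. So it equals the
cyclotomic ideal (`cycloSubmodule_eq`).

Commutative algebra. Homogeneity in the nonnegatively graded ring shows that `g_{w,ν,r}` has degree
`N_{w,ν,r}` in `x_r`, with a unit as leading coefficient and only earlier variables in the rest
(`isTop_gProd`). For such a triangular system, small monomials and small multiples of the `g` have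
as leading exponents each exponent vector exactly once. Together they are a basis of the polynomial
ring, and the small multiples are a basis of the ideal. Both assertions follow on transporting this
through the PBW decomposition. -/

namespace KLRAlg

/-! ### Inversions, reduced words and Matsumoto's theorem for the symmetric group. -/

section Inversions

variable {n : ℕ}

theorem lo_lt_hi (l : Fin (n - 1)) : lo l < hi l := by simp [lo, hi, Fin.lt_def]

theorem lo_ne_hi (l : Fin (n - 1)) : lo l ≠ hi l := (lo_lt_hi l).ne

@[simp] theorem simple_lo (l : Fin (n - 1)) : simple l (lo l) = hi l := Equiv.swap_apply_left _ _

@[simp] theorem simple_hi (l : Fin (n - 1)) : simple l (hi l) = lo l := Equiv.swap_apply_right _ _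

theorem simple_of_ne {l : Fin (n - 1)} {t : Fin n} (h₁ : t ≠ lo l) (h₂ : t ≠ hi l) :
    simple l t = t := Equiv.swap_apply_of_ne_of_ne h₁ h₂

@[simp] theorem simple_mul_self (l : Fin (n - 1)) : simple l * simple l = 1 :=
  Equiv.swap_mul_self _ _

@[simp] theorem simple_inv (l : Fin (n - 1)) : (simple l)⁻¹ = simple l := Equiv.swap_inv _ _

@[simp] theorem simple_simple (l : Fin (n - 1)) (t : Fin n) : simple l (simple l t) = t :=
  Equiv.swap_apply_self _ _ _

@[simp] theorem simple_mul_simple_mul (l : Fin (n - 1)) (w : Equiv.Perm (Fin n)) :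
    simple l * (simple l * w) = w := by rw [← mul_assoc, simple_mul_self, one_mul]

@[simp] theorem mul_simple_mul_simple (l : Fin (n - 1)) (w : Equiv.Perm (Fin n)) :
    w * simple l * simple l = w := by rw [mul_assoc, simple_mul_self, mul_one]

theorem simple_lt_simple {l : Fin (n - 1)} {s t : Fin n} (h : s < t)
    (hne : ¬ (s = lo l ∧ t = hi l)) : simple l s < simple l t := by
  have hl : (lo l).1 = l.1 := rfl
  have hh : (hi l).1 = l.1 + 1 := rfl
  by_cases s1 : s = lo l
  · subst s1
    have t2 : t ≠ hi l := fun h => hne ⟨rfl, h⟩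
    rw [simple_lo, simple_of_ne h.ne' t2]
    simp only [Fin.lt_def, Fin.ext_iff] at *
    omega
  by_cases s2 : s = hi l
  · subst s2
    have t1 : t ≠ lo l := by rintro rfl; exact absurd h (lo_lt_hi l).le.not_gt
    rw [simple_hi, simple_of_ne t1 h.ne']
    exact (lo_lt_hi l).trans h
  rw [simple_of_ne s1 s2]
  by_cases t1 : t = lo l
  · subst t1
    rw [simple_lo]; exact h.trans (lo_lt_hi l)
  by_cases t2 : t = hi l
  · subst t2
    rw [simple_hi]
    simp only [Fin.lt_def, Fin.ext_iff] at *
    omega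
  rwa [simple_of_ne t1 t2]

theorem simple_braid {l m : Fin (n - 1)} (h : m.1 = l.1 + 1) :
    simple m * simple l * simple m = simple l * simple m * simple l := by
  have hlm : lo m = hi l := Fin.ext h
  have h1 : lo l ≠ hi m := by simp [lo, hi, Fin.ext_iff, h]; omega
  have h2 := lo_ne_hi l
  have h3 := lo_ne_hi m
  rw [hlm] at h3
  simp only [simple, hlm]
  rw [Equiv.swap_mul_swap_mul_swap h2 h1, Equiv.swap_comm (lo l) (hi l),
    Equiv.swap_comm (hi l) (hi m), Equiv.swap_mul_swap_mul_swap h3.symm h1.symm,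
    Equiv.swap_comm]

theorem far_ne {l m : Fin (n - 1)} (h : l.1 + 1 < m.1 ∨ m.1 + 1 < l.1) :
    lo l ≠ lo m ∧ lo l ≠ hi m ∧ hi l ≠ lo m ∧ hi l ≠ hi m := by
  simp only [lo, hi, ne_eq, Fin.ext_iff]
  omega

theorem simple_comm {l m : Fin (n - 1)} (h : l.1 + 1 < m.1 ∨ m.1 + 1 < l.1) :
    simple l * simple m = simple m * simple l := by
  obtain ⟨h1, h2, h3, h4⟩ := far_ne h
  exact (Equiv.Perm.disjoint_swap_swap (by
    simp [h1, h2, h3, h4, lo_ne_hi])).commute.eq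

/-- The set of inversions of a permutation. -/
def inversions (w : Equiv.Perm (Fin n)) : Finset (Fin n × Fin n) :=
  Finset.univ.filter fun p => p.1 < p.2 ∧ w p.2 < w p.1

/-- The number of inversions of a permutation. -/
def inv (w : Equiv.Perm (Fin n)) : ℕ := (inversions w).card

theorem mem_inversions {w : Equiv.Perm (Fin n)} {p : Fin n × Fin n} :
    p ∈ inversions w ↔ p.1 < p.2 ∧ w p.2 < w p.1 := by simp [inversions]

/-- Applying `s_l` to both members of a pair carries the inversions of `w` to those of `w s_l`. Only
the pair `(lo l, hi l)` has its order reversed, and it is the one new inversion. -/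
theorem inv_mul_simple_of_lt {w : Equiv.Perm (Fin n)} {l : Fin (n - 1)}
    (h : w (lo l) < w (hi l)) : inv (w * simple l) = inv w + 1 := by
  have key : inversions (w * simple l) = insert (lo l, hi l)
      ((inversions w).map ((simple l).prodCongr (simple l)).toEmbedding) := by
    ext ⟨s, t⟩
    simp only [Finset.mem_insert, Finset.mem_map_equiv, mem_inversions, Equiv.Perm.mul_apply,
      Prod.mk.injEq, Equiv.prodCongr_symm, Equiv.prodCongr_apply, Prod.map]
    rw [show (simple l).symm = simple l from simple_inv l]
    by_cases hst : s = lo l ∧ t = hi l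
    · obtain ⟨rfl, rfl⟩ := hst
      simp [lo_lt_hi, h]
    · simp only [hst, false_or]
      refine and_congr_left fun hw => ⟨fun hlt => simple_lt_simple hlt hst, fun hlt => ?_⟩
      have := simple_lt_simple (l := l) hlt (by
        rintro ⟨h1, h2⟩
        rw [h1, h2] at hw
        exact absurd hw h.le.not_gt)
      simpa using this
  rw [inv, key, Finset.card_insert_of_notMem, Finset.card_map, inv]
  simp only [Finset.mem_map_equiv, mem_inversions, Equiv.prodCongr_symm, Equiv.prodCongr_apply,
    Prod.map]
  rw [show (simple l).symm = simple l from simple_inv l]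
  simp [(lo_lt_hi l).le]

theorem inv_inv (w : Equiv.Perm (Fin n)) : inv w⁻¹ = inv w := by
  refine Finset.card_bij' (fun p _ => (w⁻¹ p.2, w⁻¹ p.1)) (fun p _ => (w p.2, w p.1)) ?_ ?_ ?_ ?_ <;>
    simp +contextual [mem_inversions]

theorem inv_simple_mul_of_lt {w : Equiv.Perm (Fin n)} {l : Fin (n - 1)}
    (h : w⁻¹ (lo l) < w⁻¹ (hi l)) : inv (simple l * w) = inv w + 1 := by
  rw [← inv_inv, mul_inv_rev, simple_inv, inv_mul_simple_of_lt h, inv_inv]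

theorem inv_simple_mul_of_gt {w : Equiv.Perm (Fin n)} {l : Fin (n - 1)}
    (h : w⁻¹ (hi l) < w⁻¹ (lo l)) : inv w = inv (simple l * w) + 1 := by
  have := inv_simple_mul_of_lt (w := simple l * w) (l := l) (by simpa [mul_inv_rev] using h)
  simpa using this

theorem ascent_or_descent (w : Equiv.Perm (Fin n)) (l : Fin (n - 1)) :
    w (lo l) < w (hi l) ∨ w (hi l) < w (lo l) :=
  lt_or_gt_of_ne fun h => lo_ne_hi l (w.injective h)

theorem eq_one_of_forall_ascent {w : Equiv.Perm (Fin n)}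
    (h : ∀ l : Fin (n - 1), w (lo l) < w (hi l)) : w = 1 := by
  cases n with
  | zero => exact Subsingleton.elim _ _
  | succ n =>
    have hm : StrictMono w := Fin.strictMono_iff_lt_succ.2 fun i => h i
    have := Subsingleton.elim (hm.orderIsoOfSurjective w w.surjective) (OrderIso.refl _)
    ext t
    exact congrArg (fun f : Fin (n + 1) ≃o Fin (n + 1) => (f t).1) this

theorem inv_one : inv (1 : Equiv.Perm (Fin n)) = 0 := by
  simp only [inv, Finset.card_eq_zero, inversions, Finset.filter_eq_empty_iff]
  rintro p - ⟨h1, h2⟩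
  exact absurd h1 h2.le.not_gt

theorem inv_simple_mul_le (w : Equiv.Perm (Fin n)) (l : Fin (n - 1)) :
    inv (simple l * w) ≤ inv w + 1 := by
  rcases ascent_or_descent w⁻¹ l with h | h
  · exact (inv_simple_mul_of_lt h).le
  · have := inv_simple_mul_of_gt h; omega

theorem inv_prod_le (u : List (Fin (n - 1))) : inv (u.map simple).prod ≤ u.length := by
  induction u with
  | nil => simp [inv_one]
  | cons l u ih =>
    rw [List.map_cons, List.prod_cons, List.length_cons]
    exact (inv_simple_mul_le _ _).trans (by omega)

theorem exists_word (w : Equiv.Perm (Fin n)) :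
    ∃ u : List (Fin (n - 1)), (u.map simple).prod = w ∧ u.length = inv w := by
  induction h : inv w using Nat.strong_induction_on generalizing w with
  | _ N ih =>
    by_cases hw : ∀ l : Fin (n - 1), w⁻¹ (lo l) < w⁻¹ (hi l)
    · have : w = 1 := inv_eq_one.1 (eq_one_of_forall_ascent hw)
      subst this
      exact ⟨[], by simp, by simp [← h, inv_one]⟩
    · push Not at hw
      obtain ⟨l, hl⟩ := hw
      have hd := inv_simple_mul_of_gt ((ascent_or_descent w⁻¹ l).resolve_left hl.not_gt)
      obtain ⟨u, hu, hlen⟩ := ih (inv (simple l * w)) (by omega) _ rfl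
      exact ⟨l :: u, by simp [hu], by simp [hlen]; omega⟩

/-- A letter raises the inversion number by at most one, and removing descents one by one attains
the bound. Minimality of a word thus becomes a count. -/
theorem isReducedWord_iff {u : List (Fin (n - 1))} {w : Equiv.Perm (Fin n)} :
    IsReducedWord u w ↔ (u.map simple).prod = w ∧ u.length = inv w := by
  refine and_congr_right fun hu => ⟨fun h => ?_, fun h u' hu' => ?_⟩
  · obtain ⟨v, hv, hlen⟩ := exists_word w
    refine le_antisymm (hlen ▸ h v hv) ?_
    rw [← hu]; exact inv_prod_le u
  · rw [h, ← hu']; exact inv_prod_le u'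

theorem IsReducedWord.cons {u : List (Fin (n - 1))} {w : Equiv.Perm (Fin n)} {l : Fin (n - 1)}
    (hu : IsReducedWord u w) (h : w⁻¹ (lo l) < w⁻¹ (hi l)) :
    IsReducedWord (l :: u) (simple l * w) := by
  rw [isReducedWord_iff] at hu ⊢
  exact ⟨by simp [hu.1], by simp [hu.2, inv_simple_mul_of_lt h]⟩

theorem IsReducedWord.append {u : List (Fin (n - 1))} {w : Equiv.Perm (Fin n)} {l : Fin (n - 1)}
    (hu : IsReducedWord u w) (h : w (lo l) < w (hi l)) :
    IsReducedWord (u ++ [l]) (w * simple l) := by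
  rw [isReducedWord_iff] at hu ⊢
  exact ⟨by simp [hu.1], by simp [hu.2, inv_mul_simple_of_lt h]⟩

theorem isReducedWord_one {u : List (Fin (n - 1))} (hu : IsReducedWord u 1) : u = [] :=
  List.length_eq_zero_iff.1 ((isReducedWord_iff.1 hu).2.trans inv_one)

theorem IsReducedWord.of_cons {u : List (Fin (n - 1))} {w : Equiv.Perm (Fin n)} {l : Fin (n - 1)}
    (hu : IsReducedWord (l :: u) w) :
    IsReducedWord u (simple l * w) ∧ w⁻¹ (hi l) < w⁻¹ (lo l) := by
  rw [isReducedWord_iff] at hu ⊢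
  obtain ⟨h1, h2⟩ := hu
  have hp : (u.map simple).prod = simple l * w := by rw [← h1]; simp
  have hle := inv_prod_le u
  rw [hp] at hle
  have hd : w⁻¹ (hi l) < w⁻¹ (lo l) := by
    refine (ascent_or_descent w⁻¹ l).resolve_left fun h => ?_
    have := inv_simple_mul_of_lt h
    simp at h2; omega
  refine ⟨⟨hp, ?_⟩, hd⟩
  have := inv_simple_mul_of_gt hd
  simp at h2; omega

/-- Matsumoto's theorem for the symmetric group. -/
theorem prod_map_eq_of_isReducedWord {M : Type*} [Monoid M] (T : Fin (n - 1) → M)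
    (hcomm : ∀ l m : Fin (n - 1), (l.1 + 1 < m.1 ∨ m.1 + 1 < l.1) → T l * T m = T m * T l)
    (hbraid : ∀ l m : Fin (n - 1), m.1 = l.1 + 1 → T m * T l * T m = T l * T m * T l)
    {u v : List (Fin (n - 1))} {w : Equiv.Perm (Fin n)}
    (hu : IsReducedWord u w) (hv : IsReducedWord v w) :
    (u.map T).prod = (v.map T).prod := by
  induction hN : u.length using Nat.strong_induction_on generalizing u v w with
  | _ N ih =>
  have hlen : u.length = v.length := by
    rw [(isReducedWord_iff.1 hu).2, (isReducedWord_iff.1 hv).2]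
  -- Adjacent first letters: both are left descents of `w`, so `w = s_l s_m s_l z = s_m s_l s_m z`
  -- with lengths adding. Induction rewrites the two tails accordingly, and the braid relation joins
  -- them.
  have key : ∀ (l m : Fin (n - 1)) (u v : List (Fin (n - 1))), m.1 = l.1 + 1 →
      IsReducedWord (l :: u) w → IsReducedWord (m :: v) w → u.length + 1 = N →
      T l * (u.map T).prod = T m * (v.map T).prod := by
    intro l m u v hlm hu hv hN
    have hm : lo m = hi l := Fin.ext hlm
    have hne : lo l ≠ hi m := by simp [lo, hi, Fin.ext_iff, hlm]; omega
    obtain ⟨hu', hl⟩ := hu.of_cons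
    obtain ⟨hv', hl'⟩ := hv.of_cons
    have hNv : v.length + 1 = N := by
      have h1 := (isReducedWord_iff.1 hu).2
      have h2 := (isReducedWord_iff.1 hv).2
      simp at h1 h2; omega
    rw [hm] at hl'
    have e1 : simple l (hi m) = hi m := simple_of_ne hne.symm (hm ▸ (lo_ne_hi m).symm)
    have e2 : simple m (lo l) = lo l := simple_of_ne (hm ▸ lo_ne_hi l) hne
    have e3 : simple m (hi l) = hi m := by rw [← hm, simple_lo]
    have e4 : simple m (hi m) = hi l := by rw [← hm, simple_hi]
    obtain ⟨z, hz, hzl⟩ := exists_word (simple l * (simple m * (simple l * w)))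
    have hz := isReducedWord_iff.2 ⟨hz, hzl⟩
    have hbr : simple l * (simple m * (simple l * w)) = simple m * (simple l * (simple m * w)) := by
      simp only [← mul_assoc, simple_braid hlm]
    have r1 := (hz.cons (l := l) (by simpa [mul_inv_rev, e1, e2, e3] using hl')).cons (l := m)
      (by simpa [mul_inv_rev, hm, e1, e3] using hl'.trans hl)
    have r2 := ((hbr ▸ hz).cons (l := m) (by simpa [mul_inv_rev, hm, e1, e2, e3, e4] using hl)).cons
      (l := l) (by simpa [mul_inv_rev, e2, e3] using hl'.trans hl)
    simp only [simple_mul_simple_mul] at r1 r2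
    have i1 := ih u.length (by omega) hu' r1 rfl
    have i2 := ih v.length (by omega) hv' r2 rfl
    rw [i1, i2]
    simp only [List.map_cons, List.prod_cons, ← mul_assoc]
    rw [hbraid l m hlm]
  cases u with
  | nil => rw [List.length_eq_zero_iff.1 hlen.symm]
  | cons l u =>
    cases v with
    | nil => simp at hlen
    | cons m v =>
      simp only [List.length_cons] at hN hlen
      simp only [List.map_cons, List.prod_cons]
      obtain ⟨hu', hl⟩ := hu.of_cons
      obtain ⟨hv', hm⟩ := hv.of_cons
      by_cases hlm : l = m
      · subst hlm
        rw [ih u.length (by omega) hu' hv' rfl]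
      by_cases hfar : l.1 + 1 < m.1 ∨ m.1 + 1 < l.1
      · obtain ⟨h1, h2, h3, h4⟩ := far_ne hfar
        -- Distant first letters: here `w = s_l s_m z = s_m s_l z` with lengths adding.
        obtain ⟨z, hz, hzl⟩ := exists_word (simple l * (simple m * w))
        have hz := isReducedWord_iff.2 ⟨hz, hzl⟩
        have hc : simple l * (simple m * w) = simple m * (simple l * w) := by
          simp only [← mul_assoc, simple_comm hfar]
        have r2 := hz.cons (l := l) (by
          simpa [mul_inv_rev, simple_of_ne h1 h2, simple_of_ne h3 h4] using hl)
        have r1 := (hc ▸ hz).cons (l := m) (by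
          simpa [mul_inv_rev, simple_of_ne h1.symm h3.symm, simple_of_ne h2.symm h4.symm] using hm)
        simp only [simple_mul_simple_mul] at r1 r2
        rw [ih u.length (by omega) hu' r1 rfl, ih v.length (by omega) hv' r2 rfl]
        simp only [List.map_cons, List.prod_cons, ← mul_assoc, hcomm l m hfar]
      · have : l.1 ≠ m.1 := fun h => hlm (Fin.ext h)
        rcases (by omega : m.1 = l.1 + 1 ∨ l.1 = m.1 + 1) with h | h
        · exact key l m u v h hu hv (by omega)
        · exact (key m l v u h hv hu (by omega)).symm

end Inversions
-- Evaluation of polynomials at commuting elements.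
section Evaluation

variable {k : Type*} [CommRing k] {n : ℕ}

theorem map_monom {R S F : Type*} [Ring R] [Ring S] [FunLike F R S] [RingHomClass F R S] (g : F)
    (x : Fin n → R) (a : Fin n → ℕ) : g (monom x a) = monom (fun t => g (x t)) a := by
  simp [monom, map_list_prod, List.map_ofFn, Function.comp_def]

theorem map_evalAt {R S : Type*} [Ring R] [Ring S] [Algebra k R] [Algebra k S] (g : R →ₐ[k] S)
    (x : Fin n → R) (f : MvPolynomial (Fin n) k) :
    g (evalAt x f) = evalAt (fun t => g (x t)) f := by
  simp [evalAt, map_sum, map_monom]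

-- `evalAt` need not be multiplicative in a noncommutative ring. Commuting elements generate a
-- commutative subalgebra, in which it is `aeval`.
open scoped IsMulCommutative in
theorem exists_algHom_eq_evalAt {R : Type*} [Ring R] [Algebra k R] (x : Fin n → R)
    (hx : ∀ s t, x s * x t = x t * x s) :
    ∃ φ : MvPolynomial (Fin n) k →ₐ[k] R, (∀ f, φ f = evalAt x f) ∧
      ∀ t, φ (MvPolynomial.X t) = x t := by
  let C := Algebra.adjoin k (Set.range x)
  have : IsMulCommutative C := Algebra.isMulCommutative_adjoin k (by
    rintro _ ⟨s, rfl⟩ _ ⟨t, rfl⟩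
    exact hx s t)
  let y : Fin n → C := fun t => ⟨x t, Algebra.subset_adjoin ⟨t, rfl⟩⟩
  refine ⟨C.val.comp (MvPolynomial.aeval y), fun f => ?_, fun t => by simp [y]⟩
  rw [AlgHom.comp_apply, ← evalAt_eq_aeval, map_evalAt]
  rfl

theorem evalAt_monomial {R : Type*} [Ring R] [Algebra k R] (x : Fin n → R) (m : Fin n →₀ ℕ) :
    evalAt x (MvPolynomial.monomial m (1 : k)) = monom x m := by
  -- Over the zero ring `monomial m 1` has empty support, so this case is separate.
  rcases subsingleton_or_nontrivial k with h | h
  · have := Module.subsingleton k R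
    exact Subsingleton.elim _ _
  · simp [evalAt]

end Evaluation

/-! ### Weights and the action of the symmetric group on them. -/

section Weights

variable {I P : Type*} [AddCommGroup P] {D : CartanDatum I P} {n : ℕ} {β : P}

/-- Linear independence of the simple roots lets one read off from the sum how often each colour
occurs. All weights of β are therefore rearrangements of one another. -/
theorem CartanDatum.count_eq (D : CartanDatum I P) [DecidableEq I] {ν μ : Fin n → I}
    (h : ∑ t, D.root (ν t) = ∑ t, D.root (μ t)) (i : I) :
    ({t | ν t = i} : Finset (Fin n)).card = ({t | μ t = i} : Finset (Fin n)).card := by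
  have key : ∑ t, Finsupp.single (ν t) (1 : ℤ) = ∑ t, Finsupp.single (μ t) (1 : ℤ) := by
    apply D.root_linearIndependent
    simpa only [map_sum, Finsupp.linearCombination_single, one_smul] using h
  have h := DFunLike.congr_fun key i
  simp only [Finsupp.finsetSum_apply, Finsupp.single_apply] at h
  rw [Finset.sum_boole, Finset.sum_boole] at h
  exact_mod_cast h

theorem Weight.injective {i : Fin n → I} (hi : Function.Injective i)
    (hβ : β = ∑ j, D.root (i j)) (ν : Weight D n β) : Function.Injective ν.1 := by
  classical
  intro s t hst
  have h1 : ({j | ν.1 j = ν.1 s} : Finset (Fin n)).card ≤ 1 := by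
    rw [D.count_eq (ν.2.trans hβ)]
    exact Finset.card_le_one.2 fun a ha b hb => hi (by
      rw [(Finset.mem_filter.1 ha).2, (Finset.mem_filter.1 hb).2])
  exact Finset.card_le_one.1 h1 s (by simp) t (by simp [hst])

theorem Weight.exists_eq (ν μ : Weight D n β) (t : Fin n) : ∃ s, ν.1 s = μ.1 t := by
  classical
  have h := D.count_eq (ν.2.trans μ.2.symm) (μ.1 t)
  have hpos : 0 < ({s | ν.1 s = μ.1 t} : Finset (Fin n)).card := by
    rw [h]; exact Finset.card_pos.2 ⟨t, by simp⟩
  obtain ⟨s, hs⟩ := Finset.card_pos.1 hpos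
  exact ⟨s, (Finset.mem_filter.1 hs).2⟩

theorem Weight.act_apply (w : Equiv.Perm (Fin n)) (ν : Weight D n β) (t : Fin n) :
    (ν.act w).1 t = ν.1 (w⁻¹ t) := rfl

theorem Weight.act_mul (v w : Equiv.Perm (Fin n)) (ν : Weight D n β) :
    ν.act (v * w) = (ν.act w).act v := rfl

theorem Weight.act_one (ν : Weight D n β) : ν.act 1 = ν := rfl

@[simp] theorem Weight.act_simple_act_simple (l : Fin (n - 1)) (ν : Weight D n β) :
    (ν.act (simple l)).act (simple l) = ν := by
  rw [← Weight.act_mul, simple_mul_self, Weight.act_one]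

theorem Weight.act_injective_left {ν : Weight D n β} (hν : Function.Injective ν.1) :
    Function.Injective fun w : Equiv.Perm (Fin n) => ν.act w := by
  intro v w h
  have : v⁻¹ = w⁻¹ := Equiv.ext fun t => hν (congrFun (congrArg Subtype.val h) t)
  exact inv_injective this

end Weights

/-! ### The relations without correction terms, and the spanning half of the PBW theorem. -/

section Relations

variable {I P k : Type*} [AddCommGroup P] [CommRing k] {D : CartanDatum I P}
  {A : ℕ → AddSubgroup k}

theorem QMatrix.rename_at (Q : QMatrix D A) {n : ℕ} (g : Fin n → Fin n) (i j : I) (s t : Fin n) :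
    MvPolynomial.rename g (Q.at i j s t) = Q.at i j (g s) (g t) := by
  rw [QMatrix.at, QMatrix.at, ← AlgHom.comp_apply]
  congr 1
  ext m
  fin_cases m <;> simp

variable [Module.Finite ℤ P]

namespace KLR

variable (Q : QMatrix D A) {n : ℕ} {β : P}

theorem mk_rel {a b : FreeAlgebra k (Gen D n β)} (h : Rel Q n β a b) : mk Q a = mk Q b :=
  RingQuot.mkAlgHom_rel k h

theorem e_mul_self (ν : Weight D n β) : e Q ν * e Q ν = e Q ν := by
  simpa [e, x, tau] using mk_rel Q (Rel.e_mul_self ν)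

theorem e_mul_ne {ν ν' : Weight D n β} (h : ν ≠ ν') : e Q ν * e Q ν' = 0 := by
  simpa [e, x, tau] using mk_rel Q (Rel.e_mul_ne ν ν' h)

theorem sum_e : ∑ ν : Weight D n β, e Q ν = 1 := by
  simpa [e, x, tau] using mk_rel Q (Rel.sum_e (n := n) (β := β))

theorem x_comm (s t : Fin n) : x Q s * x Q t = x (β := β) Q t * x Q s := by
  simpa [e, x, tau] using mk_rel Q (Rel.x_comm (n := n) (β := β) s t)

theorem x_e (t : Fin n) (ν : Weight D n β) : x Q t * e Q ν = e Q ν * x Q t := by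
  simpa [e, x, tau] using mk_rel Q (Rel.x_e t ν)

theorem tau_e (l : Fin (n - 1)) (ν : Weight D n β) :
    tau Q l * e Q ν = e Q (ν.act (simple l)) * tau Q l := by
  simpa [e, x, tau] using mk_rel Q (Rel.tau_e l ν)

theorem e_tau (l : Fin (n - 1)) (ν : Weight D n β) :
    e Q ν * tau Q l = tau Q l * e Q (ν.act (simple l)) := by
  rw [tau_e, Weight.act_simple_act_simple]

theorem tau_comm {l m : Fin (n - 1)} (h : l.1 + 1 < m.1 ∨ m.1 + 1 < l.1) :
    tau Q l * tau Q m = tau (β := β) Q m * tau Q l := by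
  simpa [e, x, tau] using mk_rel Q (Rel.tau_comm (n := n) (β := β) l m h)

theorem eq_of_forall_mul_e {a b : KLR Q n β} (h : ∀ ν, a * e Q ν = b * e Q ν) : a = b := by
  rw [← mul_one a, ← mul_one b, ← sum_e, Finset.mul_sum, Finset.mul_sum]
  exact Finset.sum_congr rfl fun ν _ => h ν

/-- The homomorphism from the polynomial ring that sends the variables to `x_1, …, x_n`. -/
noncomputable def poly : MvPolynomial (Fin n) k →ₐ[k] KLR Q n β :=
  (exists_algHom_eq_evalAt (x Q) (x_comm Q)).choose

theorem poly_eq_evalAt (f : MvPolynomial (Fin n) k) : poly (β := β) Q f = evalAt (x Q) f :=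
  (exists_algHom_eq_evalAt (x Q) (x_comm Q)).choose_spec.1 f

theorem poly_X (t : Fin n) : poly (β := β) Q (MvPolynomial.X t) = x Q t :=
  (exists_algHom_eq_evalAt (x Q) (x_comm Q)).choose_spec.2 t

theorem poly_monomial (m : Fin n →₀ ℕ) :
    poly (β := β) Q (MvPolynomial.monomial m 1) = monom (x Q) m := by
  rw [poly_eq_evalAt, evalAt_monomial]

theorem poly_mul_e (f : MvPolynomial (Fin n) k) (ν : Weight D n β) :
    poly Q f * e Q ν = e Q ν * poly Q f := by
  induction f using MvPolynomial.induction_on with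
  | C c => rw [MvPolynomial.algHom_C, Algebra.commutes]
  | add f g hf hg => rw [map_add, add_mul, hf, hg, mul_add]
  | mul_X f t hf => rw [map_mul, poly_X, mul_assoc, x_e, ← mul_assoc, hf, mul_assoc]

theorem tau_sq_e (l : Fin (n - 1)) (ν : Weight D n β) :
    tau Q l * tau Q l * e Q ν =
      poly Q (Q.at (ν.1 (lo l)) (ν.1 (hi l)) (lo l) (hi l)) * e Q ν := by
  have := mk_rel Q (Rel.tau_sq l ν)
  rw [map_mul, map_mul, map_mul, map_evalAt] at this
  rw [poly_eq_evalAt]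
  exact this

theorem tauWord_mul_e (u : List (Fin (n - 1))) (ν : Weight D n β) :
    tauWord Q u * e Q ν = e Q (ν.act (u.map simple).prod) * tauWord Q u := by
  induction u with
  | nil => simp [tauWord, Weight.act_one]
  | cons l u ih =>
    simp only [tauWord, List.map_cons, List.prod_cons] at ih ⊢
    rw [mul_assoc, ih, ← mul_assoc, tau_e, mul_assoc, Weight.act_mul]

theorem induction {p : KLR Q n β → Prop} (algebraMap : ∀ c : k, p (algebraMap k _ c))
    (e : ∀ ν, p (e Q ν)) (x : ∀ t, p (x Q t)) (tau : ∀ l, p (tau Q l))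
    (add : ∀ a b, p a → p b → p (a + b)) (mul : ∀ a b, p a → p b → p (a * b))
    (r : KLR Q n β) : p r := by
  obtain ⟨y, rfl⟩ : ∃ y, mk Q y = r := RingQuot.mkAlgHom_surjective k (Rel Q n β) r
  induction y using FreeAlgebra.induction with
  | grade0 c => rw [AlgHom.commutes]; exact algebraMap c
  | grade1 g => cases g with
    | e ν => exact e ν
    | x t => exact x t
    | tau l => exact tau l
  | mul a b ha hb => rw [map_mul]; exact mul _ _ ha hb
  | add a b ha hb => rw [map_add]; exact add _ _ ha hb

section MultiplicityFree

variable {Q} (hinj : ∀ ν : Weight D n β, Function.Injective ν.1)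
include hinj

theorem tau_x (l : Fin (n - 1)) (t : Fin n) :
    tau Q l * x Q t = x (β := β) Q (simple l t) * tau Q l := by
  refine eq_of_forall_mul_e Q fun ν => ?_
  have := mk_rel Q (Rel.tau_x l t ν fun h => lo_ne_hi l (hinj ν h.2))
  rw [map_mul, map_sub, map_mul, map_mul, map_zero, sub_mul, sub_eq_zero] at this
  exact this

theorem tau_braid {l m : Fin (n - 1)} (h : m.1 = l.1 + 1) :
    tau Q m * tau Q l * tau Q m = tau (β := β) Q l * tau Q m * tau Q l := by
  refine eq_of_forall_mul_e Q fun ν => ?_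
  have := mk_rel Q (Rel.braid_ne l m h ν fun h' => by
    have := congrArg Fin.val (hinj ν h')
    simp [lo, hi] at this
    omega)
  simp only [map_mul, map_sub, map_zero, sub_mul, sub_eq_zero] at this
  exact this

/-- With distinct entries the `τ_l` satisfy the exact commutation and braid relations, which is all
that Matsumoto's theorem requires. -/
theorem tauWord_eq {u v : List (Fin (n - 1))} {w : Equiv.Perm (Fin n)}
    (hu : IsReducedWord u w) (hv : IsReducedWord v w) :
    tauWord (β := β) Q u = tauWord Q v :=
  prod_map_eq_of_isReducedWord (tau Q) (fun _ _ h => tau_comm Q h) (fun _ _ h => tau_braid hinj h)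
    hu hv

theorem tau_mul_poly (l : Fin (n - 1)) (f : MvPolynomial (Fin n) k) :
    tau Q l * poly Q f = poly (β := β) Q (MvPolynomial.rename (simple l) f) * tau Q l := by
  induction f using MvPolynomial.induction_on with
  | C c => rw [MvPolynomial.rename_C, MvPolynomial.algHom_C, Algebra.commutes]
  | add f g hf hg => rw [map_add, map_add, map_add, add_mul, mul_add, hf, hg]
  | mul_X f t hf =>
    rw [map_mul, map_mul, map_mul, ← mul_assoc, hf, MvPolynomial.rename_X, poly_X, poly_X,
      mul_assoc, tau_x hinj, mul_assoc]

theorem poly_mul_tau (l : Fin (n - 1)) (f : MvPolynomial (Fin n) k) :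
    poly Q f * tau Q l = tau (β := β) Q l * poly Q (MvPolynomial.rename (simple l) f) := by
  rw [tau_mul_poly hinj, MvPolynomial.rename_rename, ← Equiv.Perm.coe_mul, simple_mul_self,
    Equiv.Perm.coe_one, MvPolynomial.rename_id_apply]

theorem poly_mul_tauWord (u : List (Fin (n - 1))) (f : MvPolynomial (Fin n) k) :
    poly Q f * tauWord Q u = tauWord (β := β) Q u *
      poly Q (MvPolynomial.rename ((u.map simple).prod⁻¹ : Equiv.Perm (Fin n)) f) := by
  induction u generalizing f with
  | nil => simp [tauWord]
  | cons l u ih =>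
    simp only [tauWord, List.map_cons, List.prod_cons] at ih ⊢
    rw [← mul_assoc, poly_mul_tau hinj, mul_assoc, ih, mul_assoc, MvPolynomial.rename_rename,
      ← Equiv.Perm.coe_mul, mul_inv_rev, simple_inv]

end MultiplicityFree

variable {red : Equiv.Perm (Fin n) → List (Fin (n - 1))}

variable (red) in
/-- The element `τ_w f(x_1, …, x_n) e(ν)`. -/
noncomputable def stdElt (w : Equiv.Perm (Fin n)) (f : MvPolynomial (Fin n) k)
    (ν : Weight D n β) : KLR Q n β :=
  tauWord Q (red w) * poly Q f * e Q ν

theorem stdElt_add (w : Equiv.Perm (Fin n)) (f g : MvPolynomial (Fin n) k) (ν : Weight D n β) :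
    stdElt Q red w (f + g) ν = stdElt Q red w f ν + stdElt Q red w g ν := by
  simp [stdElt, mul_add, add_mul]

theorem stdElt_smul (w : Equiv.Perm (Fin n)) (c : k) (f : MvPolynomial (Fin n) k)
    (ν : Weight D n β) : stdElt Q red w (c • f) ν = c • stdElt Q red w f ν := by
  simp [stdElt]

variable (red) in
/-- The linear map `f ↦ τ_w f(x_1, …, x_n) e(ν)`. -/
noncomputable def stdMap (w : Equiv.Perm (Fin n)) (ν : Weight D n β) :
    MvPolynomial (Fin n) k →ₗ[k] KLR Q n β where
  toFun f := stdElt Q red w f ν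
  map_add' f g := stdElt_add Q w f g ν
  map_smul' c f := stdElt_smul Q w c f ν

theorem stdElt_mul_poly (w : Equiv.Perm (Fin n)) (f g : MvPolynomial (Fin n) k)
    (ν : Weight D n β) : stdElt Q red w f ν * poly Q g = stdElt Q red w (f * g) ν := by
  rw [stdElt, mul_assoc, ← poly_mul_e, stdElt, map_mul]
  simp only [mul_assoc]

theorem stdElt_mul_x (w : Equiv.Perm (Fin n)) (f : MvPolynomial (Fin n) k)
    (ν : Weight D n β) (t : Fin n) :
    stdElt Q red w f ν * x Q t = stdElt Q red w (f * MvPolynomial.X t) ν := by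
  rw [← poly_X, stdElt_mul_poly]

theorem stdElt_mul_e_self (w : Equiv.Perm (Fin n)) (f : MvPolynomial (Fin n) k)
    (ν : Weight D n β) : stdElt Q red w f ν * e Q ν = stdElt Q red w f ν := by
  rw [stdElt, mul_assoc, e_mul_self]

theorem stdElt_mul_e_ne (w : Equiv.Perm (Fin n)) (f : MvPolynomial (Fin n) k)
    {ν μ : Weight D n β} (h : ν ≠ μ) : stdElt Q red w f ν * e Q μ = 0 := by
  rw [stdElt, mul_assoc, e_mul_ne Q h, mul_zero]

section Reduced

theorem stdElt_mul_tau (hinj : ∀ ν : Weight D n β, Function.Injective ν.1)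
    (w : Equiv.Perm (Fin n)) (l : Fin (n - 1)) (f : MvPolynomial (Fin n) k) (ν : Weight D n β) :
    stdElt Q red w f ν * tau Q l = tauWord Q (red w) * tau Q l *
      poly Q (MvPolynomial.rename (simple l) f) * e Q (ν.act (simple l)) := by
  rw [stdElt, mul_assoc, e_tau, ← mul_assoc, mul_assoc (tauWord Q _), poly_mul_tau hinj,
    ← mul_assoc]

variable (hred : ∀ w, IsReducedWord (red w) w)
include hred

theorem stdElt_eq (w : Equiv.Perm (Fin n)) (f : MvPolynomial (Fin n) k) (ν : Weight D n β) :
    stdElt Q red w f ν = e Q (ν.act w) * tauWord Q (red w) * poly Q f := by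
  rw [stdElt, mul_assoc, poly_mul_e, ← mul_assoc, tauWord_mul_e, (hred w).1]

theorem e_mul_stdElt_self (w : Equiv.Perm (Fin n)) (f : MvPolynomial (Fin n) k)
    (ν : Weight D n β) : e Q (ν.act w) * stdElt Q red w f ν = stdElt Q red w f ν := by
  rw [stdElt_eq Q hred, mul_assoc, ← mul_assoc, e_mul_self]

theorem e_mul_stdElt_ne {w : Equiv.Perm (Fin n)} (f : MvPolynomial (Fin n) k)
    {ν μ : Weight D n β} (h : μ ≠ ν.act w) : e Q μ * stdElt Q red w f ν = 0 := by
  rw [stdElt_eq Q hred, mul_assoc, ← mul_assoc, e_mul_ne Q h, zero_mul]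

theorem stdElt_one (f : MvPolynomial (Fin n) k) (ν : Weight D n β) :
    stdElt Q red 1 f ν = poly Q f * e Q ν := by
  rw [stdElt, isReducedWord_one (hred 1)]
  simp [tauWord]

variable (hinj : ∀ ν : Weight D n β, Function.Injective ν.1)
include hinj

theorem x_mul_stdElt (w : Equiv.Perm (Fin n)) (f : MvPolynomial (Fin n) k)
    (ν : Weight D n β) (t : Fin n) :
    x Q t * stdElt Q red w f ν = stdElt Q red w (MvPolynomial.X (w⁻¹ t) * f) ν := by
  rw [stdElt, ← mul_assoc, ← mul_assoc, ← poly_X, poly_mul_tauWord hinj, (hred w).1,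
    MvPolynomial.rename_X, stdElt, map_mul]
  simp only [mul_assoc]

theorem tauWord_simple_mul {w : Equiv.Perm (Fin n)} {l : Fin (n - 1)}
    (h : w⁻¹ (lo l) < w⁻¹ (hi l)) :
    tauWord (β := β) Q (red (simple l * w)) = tau Q l * tauWord Q (red w) := by
  rw [tauWord_eq hinj (hred _) ((hred w).cons h)]
  simp [tauWord]

theorem tauWord_mul_simple {w : Equiv.Perm (Fin n)} {l : Fin (n - 1)}
    (h : w (lo l) < w (hi l)) :
    tauWord (β := β) Q (red (w * simple l)) = tauWord Q (red w) * tau Q l := by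
  rw [tauWord_eq hinj (hred _) ((hred w).append h)]
  simp [tauWord]

theorem tau_mul_stdElt_of_lt {w : Equiv.Perm (Fin n)} {l : Fin (n - 1)}
    (h : w⁻¹ (lo l) < w⁻¹ (hi l)) (f : MvPolynomial (Fin n) k) (ν : Weight D n β) :
    tau Q l * stdElt Q red w f ν = stdElt Q red (simple l * w) f ν := by
  rw [stdElt, stdElt, tauWord_simple_mul Q hred hinj h]
  simp only [mul_assoc]

/-- Here `τ_w = τ_l τ_{s_l w}`, so `τ_l²` appears. It is a polynomial `Q` at the weight `s_l w.ν`,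
and moving it to the right past `τ_{s_l w}` relabels its variables. -/
theorem tau_mul_stdElt_of_gt {w : Equiv.Perm (Fin n)} {l : Fin (n - 1)}
    (h : w⁻¹ (hi l) < w⁻¹ (lo l)) (f : MvPolynomial (Fin n) k) (ν : Weight D n β) :
    tau Q l * stdElt Q red w f ν = stdElt Q red (simple l * w)
      (Q.at (ν.1 (w⁻¹ (hi l))) (ν.1 (w⁻¹ (lo l))) (w⁻¹ (hi l)) (w⁻¹ (lo l)) * f) ν := by
  have h' : (simple l * w)⁻¹ (lo l) < (simple l * w)⁻¹ (hi l) := by simpa [mul_inv_rev] using h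
  have hw := tauWord_simple_mul Q hred hinj h'
  rw [simple_mul_simple_mul] at hw
  have e1 : stdElt Q red w f ν = tau Q l * stdElt Q red (simple l * w) f ν := by
    rw [stdElt, hw, stdElt]; simp only [mul_assoc]
  rw [e1, ← e_mul_stdElt_self Q hred, ← mul_assoc, ← mul_assoc, tau_sq_e, mul_assoc,
    e_mul_stdElt_self Q hred, stdElt, ← mul_assoc, ← mul_assoc, poly_mul_tauWord hinj,
    (hred _).1, QMatrix.rename_at, mul_assoc (tauWord Q _), ← map_mul, stdElt]
  simp [Weight.act_apply, mul_inv_rev]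

theorem stdElt_mul_tau_of_lt {w : Equiv.Perm (Fin n)} {l : Fin (n - 1)}
    (h : w (lo l) < w (hi l)) (f : MvPolynomial (Fin n) k) (ν : Weight D n β) :
    stdElt Q red w f ν * tau Q l = stdElt Q red (w * simple l)
      (MvPolynomial.rename (simple l) f) (ν.act (simple l)) := by
  rw [stdElt_mul_tau Q hinj, stdElt, tauWord_mul_simple Q hred hinj h]

theorem stdElt_mul_tau_of_gt {w : Equiv.Perm (Fin n)} {l : Fin (n - 1)}
    (h : w (hi l) < w (lo l)) (f : MvPolynomial (Fin n) k) (ν : Weight D n β) :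
    stdElt Q red w f ν * tau Q l = stdElt Q red (w * simple l)
      (Q.at (ν.1 (hi l)) (ν.1 (lo l)) (lo l) (hi l) * MvPolynomial.rename (simple l) f)
      (ν.act (simple l)) := by
  have h' : (w * simple l) (lo l) < (w * simple l) (hi l) := by simpa using h
  have hw := tauWord_mul_simple Q hred hinj h'
  rw [mul_simple_mul_simple] at hw
  rw [stdElt_mul_tau Q hinj, hw, mul_assoc, poly_mul_e, ← mul_assoc, mul_assoc (tauWord Q _),
    mul_assoc (tauWord Q _), tau_sq_e, stdElt, map_mul, mul_assoc, mul_assoc (poly Q _),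
    ← poly_mul_e]
  simp only [mul_assoc, Weight.act_apply, simple_inv, simple_lo, simple_hi]

/-- The span is stable under left multiplication by every generator, and it contains `1`, the sum of
the `τ_1 e(ν)`. -/
theorem span_stdElt :
    Submodule.span k {y | ∃ w f ν, y = stdElt (β := β) Q red w f ν} = ⊤ := by
  set S := Submodule.span k {y | ∃ w f ν, y = stdElt (β := β) Q red w f ν}
  have mem : ∀ w f ν, stdElt (β := β) Q red w f ν ∈ S := fun w f ν =>
    Submodule.subset_span ⟨w, f, ν, rfl⟩
  have left : ∀ r y, y ∈ S → r * y ∈ S := by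
    intro r
    have gen : ∀ r : KLR Q n β, (∀ w f ν, r * stdElt (β := β) Q red w f ν ∈ S) →
        ∀ y ∈ S, r * y ∈ S := by
      intro r h y hy
      induction hy using Submodule.span_induction with
      | mem y hy => obtain ⟨w, f, ν, rfl⟩ := hy; exact h w f ν
      | zero => rw [mul_zero]; exact S.zero_mem
      | add a b _ _ ha hb => rw [mul_add]; exact S.add_mem ha hb
      | smul c a _ ha => rw [mul_smul_comm]; exact S.smul_mem c ha
    induction r using induction with
    | algebraMap c => intro y hy; rw [← Algebra.smul_def]; exact S.smul_mem c hy
    | e μ =>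
      refine gen _ fun w f ν => ?_
      by_cases h : μ = ν.act w
      · rw [h, e_mul_stdElt_self Q hred]; exact mem _ _ _
      · rw [e_mul_stdElt_ne Q hred _ h]; exact S.zero_mem
    | x t => exact gen _ fun w f ν => by rw [x_mul_stdElt Q hred hinj]; exact mem _ _ _
    | tau l =>
      refine gen _ fun w f ν => ?_
      rcases ascent_or_descent w⁻¹ l with h | h
      · rw [tau_mul_stdElt_of_lt Q hred hinj h]; exact mem _ _ _
      · rw [tau_mul_stdElt_of_gt Q hred hinj h]; exact mem _ _ _
    | add a b ha hb => intro y hy; rw [add_mul]; exact S.add_mem (ha y hy) (hb y hy)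
    | mul a b ha hb => intro y hy; rw [mul_assoc]; exact ha _ (hb y hy)
  refine eq_top_iff.2 fun r _ => ?_
  rw [← mul_one r]
  refine left r 1 ?_
  rw [← sum_e]
  refine S.sum_mem fun ν _ => ?_
  have := mem 1 1 ν
  rwa [stdElt_one Q hred, map_one, one_mul] at this

end Reduced

end KLR

end Relations
-- The polynomial representation and the independence half of the PBW theorem.
section Representation

variable {I P k : Type*} [AddCommGroup P] [CommRing k] {D : CartanDatum I P}
  {A : ℕ → AddSubgroup k} (Q : QMatrix D A) {n : ℕ} {β : P}

/-- `Q_{ij}(X_i, X_j)` in the polynomial ring with one variable for every `i ∈ I`. -/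
noncomputable def QMatrix.color (i j : I) : MvPolynomial I k :=
  MvPolynomial.aeval ![MvPolynomial.X i, MvPolynomial.X j] (Q.Q i j)

theorem QMatrix.aeval_at (g : Fin n → I) (s t : Fin n) :
    MvPolynomial.aeval (fun t => (MvPolynomial.X (g t) : MvPolynomial I k))
      (Q.at (g s) (g t) s t) = Q.color (g s) (g t) := by
  rw [QMatrix.at, QMatrix.color, ← AlgHom.comp_apply]
  congr 1
  ext m
  fin_cases m <;> simp

theorem QMatrix.color_symm (i j : I) : Q.color i j = Q.color j i := by
  rw [QMatrix.color, QMatrix.color, Q.symm i j, MvPolynomial.aeval_rename]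
  congr 2
  ext m
  fin_cases m <;> simp

/-- The space of families of polynomials on which `R_β` acts. -/
abbrev PolyRep (k : Type*) [CommRing k] (D : CartanDatum I P) (n : ℕ) (β : P) : Type _ :=
  Weight D n β → MvPolynomial I k

open scoped Classical in
/-- The factors of the polynomial representation: `1` or `Q_{ij}(X_i, X_j)`, according to whether
`i` stands before `j` in `νt`. -/
noncomputable def repFactor (νt : Fin n → I) (i j : I) : MvPolynomial I k :=
  if Prec νt i j then 1 else Q.color i j

theorem prec_iff {ν : Fin n → I} (hν : Function.Injective ν) {s t : Fin n} :
    Prec ν (ν s) (ν t) ↔ s < t := by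
  refine ⟨?_, fun h => ⟨fun h' => h.ne (hν h'), s, t, h, rfl, rfl⟩⟩
  rintro ⟨-, a, b, h, ha, hb⟩
  rwa [← hν ha, ← hν hb]

/-- One of the two factors is `1` and the other is `Q`. Whatever the normalization, the product is
the value demanded of `τ_l²`. -/
theorem repFactor_mul {ν : Fin n → I} (hν : Function.Injective ν) {s t : Fin n} (hst : s ≠ t) :
    repFactor Q ν (ν s) (ν t) * repFactor Q ν (ν t) (ν s) = Q.color (ν s) (ν t) := by
  have key := fun a b => prec_iff hν (s := a) (t := b)
  rcases lt_or_gt_of_ne hst with h | h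
  · simp [repFactor, key, h, h.not_gt, Q.color_symm (ν t)]
  · simp [repFactor, key, h, h.not_gt]

/-- The operator by which `τ_l` acts on the polynomial representation. -/
noncomputable def repTau (νt : Fin n → I) (l : Fin (n - 1)) :
    Module.End k (PolyRep k D n β) where
  toFun F μ := repFactor Q νt (μ.1 (hi l)) (μ.1 (lo l)) * F (μ.act (simple l))
  map_add' F G := by ext1 μ; simp [mul_add]
  map_smul' c F := by ext1 μ; simp

theorem repTau_apply (νt : Fin n → I) (l : Fin (n - 1)) (F : PolyRep k D n β)
    (μ : Weight D n β) : repTau Q νt l F μ =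
      repFactor Q νt (μ.1 (hi l)) (μ.1 (lo l)) * F (μ.act (simple l)) := rfl

open scoped Classical in
/-- The action of the generators on the polynomial representation. -/
noncomputable def repGen (νt : Fin n → I) : Gen D n β → Module.End k (PolyRep k D n β)
  | .e ν => Algebra.lmul k (PolyRep k D n β) (Pi.single ν 1)
  | .x t => Algebra.lmul k (PolyRep k D n β) fun μ => MvPolynomial.X (μ.1 t)
  | .tau l => repTau Q νt l

/-- The `x_t` act through multiplication in the commutative algebra of families, where `evalAt` is
`aeval` and can be computed at each weight. -/
theorem lift_evalAt (νt : Fin n → I) (f : MvPolynomial (Fin n) k) (F : PolyRep k D n β)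
    (μ : Weight D n β) :
    FreeAlgebra.lift k (repGen Q νt) (evalAt (Free.x k) f) F μ =
      MvPolynomial.aeval (fun t => (MvPolynomial.X (μ.1 t) : MvPolynomial I k)) f * F μ := by
  rw [map_evalAt]
  simp only [Free.x, FreeAlgebra.lift_ι_apply, repGen]
  rw [← map_evalAt, evalAt_eq_aeval, Algebra.coe_lmul_eq_mul, LinearMap.mul_apply_apply,
    Pi.mul_apply]
  congr 1
  exact MvPolynomial.comp_aeval_apply
    (fun t (μ : Weight D n β) => (MvPolynomial.X (μ.1 t) : MvPolynomial I k))
    (Pi.evalAlgHom k (fun _ => MvPolynomial I k) μ) f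

theorem lift_e (νt : Fin n → I) (ν : Weight D n β) (F : PolyRep k D n β) (μ : Weight D n β)
    [Decidable (μ = ν)] :
    FreeAlgebra.lift k (repGen Q νt) (Free.e k ν) F μ = if μ = ν then F μ else 0 := by
  simp [Free.e, repGen, Pi.single_apply]

theorem lift_x (νt : Fin n → I) (t : Fin n) (F : PolyRep k D n β) (μ : Weight D n β) :
    FreeAlgebra.lift k (repGen Q νt) (Free.x k t) F μ = MvPolynomial.X (μ.1 t) * F μ := by
  simp [Free.x, repGen]

theorem lift_tau (νt : Fin n → I) (l : Fin (n - 1)) (F : PolyRep k D n β) (μ : Weight D n β) :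
    FreeAlgebra.lift k (repGen Q νt) (Free.tau k l) F μ =
      repFactor Q νt (μ.1 (hi l)) (μ.1 (lo l)) * F (μ.act (simple l)) := by
  simp [Free.tau, repGen, repTau_apply]

variable (hinj : ∀ ν : Weight D n β, Function.Injective ν.1)
include hinj

/-- The variables belong to colours, not positions, so `τ_l` need not permute them and `τ_l x_t =
x_{s_l(t)} τ_l` is automatic. Both sides of the braid relation give the same three factors, and the
relations for equal entries are void. -/
theorem lift_rel [Module.Finite ℤ P] (ν : Weight D n β) ⦃y z : FreeAlgebra k (Gen D n β)⦄
    (h : Rel Q n β y z) :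
    FreeAlgebra.lift k (repGen Q ν.1) y = FreeAlgebra.lift k (repGen Q ν.1) z := by
  classical
  refine LinearMap.ext fun F => funext fun μ => ?_
  cases h with
  | e_mul_self ν =>
    simp only [map_mul, Module.End.mul_apply, lift_e]
    split_ifs <;> rfl
  | e_mul_ne ν ν' h =>
    simp only [map_mul, Module.End.mul_apply, lift_e, map_zero, LinearMap.zero_apply,
      Pi.zero_apply]
    split_ifs with h1 h2
    · exact absurd (h1.symm.trans h2) h
    · rfl
    · rfl
  | sum_e =>
    simp only [map_sum, LinearMap.sum_apply, Finset.sum_apply, lift_e, map_one,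
      Module.End.one_apply]
    simp
  | x_comm s t =>
    simp only [map_mul, Module.End.mul_apply, lift_x]
    ring
  | x_e t ν => simp [lift_x, lift_e]
  | tau_e l ν =>
    have : μ.act (simple l) = ν ↔ μ = ν.act (simple l) :=
      ⟨fun h => by simp [← h], fun h => by simp [h]⟩
    simp [lift_tau, lift_e, this]
  | tau_comm l m h =>
    obtain ⟨h1, h2, h3, h4⟩ := far_ne h
    simp only [map_mul, Module.End.mul_apply, lift_tau, Weight.act_apply, simple_inv,
      simple_of_ne h1 h2, simple_of_ne h3 h4, simple_of_ne h1.symm h3.symm,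
      simple_of_ne h2.symm h4.symm, ← Weight.act_mul, simple_comm h]
    ring
  | tau_sq l ν' =>
    simp only [map_mul, Module.End.mul_apply, lift_tau, lift_evalAt, lift_e,
      Weight.act_simple_act_simple]
    by_cases hμ : μ = ν'
    · subst hμ
      -- The factors are normalized by ν, so the two colours of `μ` are located in ν.
      obtain ⟨a, ha⟩ := ν.exists_eq μ (lo l)
      obtain ⟨b, hb⟩ := ν.exists_eq μ (hi l)
      have hab : b ≠ a := by
        rintro rfl
        exact lo_ne_hi l (hinj μ (ha.symm.trans hb))
      rw [QMatrix.aeval_at]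
      simp only [Weight.act_apply, simple_inv, simple_lo, simple_hi, if_true]
      rw [← mul_assoc, ← ha, ← hb, repFactor_mul Q (hinj ν) hab, Q.color_symm]
    · simp [hμ]
  | tau_x_lo l ν' h => exact absurd (hinj _ h) (lo_ne_hi l)
  | tau_x_hi l ν' h => exact absurd (hinj _ h) (lo_ne_hi l)
  | tau_x l t ν' h =>
    simp only [map_mul, map_sub, Module.End.mul_apply, LinearMap.sub_apply, Pi.sub_apply, lift_tau,
      lift_x, lift_e, Weight.act_apply, simple_inv, map_zero, LinearMap.zero_apply, Pi.zero_apply]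
    ring
  | braid_eq l m hl ν' h =>
    have := congrArg Fin.val (hinj _ h)
    simp [lo, hi] at this
    omega
  | braid_ne l m hlm ν' h =>
    have hm : lo m = hi l := Fin.ext hlm
    have hne : lo l ≠ hi m := by simp [lo, hi, Fin.ext_iff, hlm]; omega
    have e1 : simple l (hi m) = hi m := simple_of_ne hne.symm (hm ▸ (lo_ne_hi m).symm)
    have e2 : simple m (lo l) = lo l := simple_of_ne (hm ▸ lo_ne_hi l) hne
    have e3 : simple m (hi l) = hi m := by rw [← hm, simple_lo]
    have e4 : simple m (hi m) = hi l := by rw [← hm, simple_hi]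
    have hb : ∀ μ : Weight D n β, ((μ.act (simple m)).act (simple l)).act (simple m) =
        ((μ.act (simple l)).act (simple m)).act (simple l) := fun μ => by
      simp only [← Weight.act_mul, ← mul_assoc, simple_braid hlm]
    simp only [map_mul, map_sub, Module.End.mul_apply, LinearMap.sub_apply, Pi.sub_apply, lift_tau,
      Weight.act_apply, simple_inv, map_zero, LinearMap.zero_apply, Pi.zero_apply, hm, e1, e2, e3,
      e4, simple_lo, simple_hi, hb]
    ring

variable [Module.Finite ℤ P]

namespace KLR

/-- The polynomial representation of `R_β`, normalized by the choice of a weight. -/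
noncomputable def rep (ν : Weight D n β) : KLR Q n β →ₐ[k] Module.End k (PolyRep k D n β) :=
  RingQuot.liftAlgHom k ⟨FreeAlgebra.lift k (repGen Q ν.1), lift_rel Q hinj ν⟩

theorem rep_mk (ν : Weight D n β) (y : FreeAlgebra k (Gen D n β)) :
    rep Q hinj ν (mk Q y) = FreeAlgebra.lift k (repGen Q ν.1) y :=
  RingQuot.liftAlgHom_mkAlgHom_apply _ _ _ _

theorem rep_poly (ν : Weight D n β) (f : MvPolynomial (Fin n) k) (F : PolyRep k D n β)
    (μ : Weight D n β) : rep Q hinj ν (poly Q f) F μ =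
      MvPolynomial.aeval (fun t => (MvPolynomial.X (μ.1 t) : MvPolynomial I k)) f * F μ := by
  rw [← lift_evalAt Q ν.1, ← rep_mk Q hinj, map_evalAt, poly_eq_evalAt]
  rfl

theorem rep_e (ν ν' : Weight D n β) (F : PolyRep k D n β) (μ : Weight D n β)
    [Decidable (μ = ν')] : rep Q hinj ν (e Q ν') F μ = if μ = ν' then F μ else 0 := by
  rw [e, rep_mk, lift_e]

theorem rep_tau (ν : Weight D n β) (l : Fin (n - 1)) (F : PolyRep k D n β)
    (μ : Weight D n β) : rep Q hinj ν (tau Q l) F μ =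
      repFactor Q ν.1 (μ.1 (hi l)) (μ.1 (lo l)) * F (μ.act (simple l)) := by
  rw [tau, rep_mk, lift_tau]

/-- Each letter of a reduced word exchanges two colours that still stand in their order in ν. Every
factor met is therefore `1`. -/
theorem rep_tauWord_single [DecidableEq (Weight D n β)] (ν : Weight D n β)
    {u : List (Fin (n - 1))} {w : Equiv.Perm (Fin n)} (hu : IsReducedWord u w) :
    rep Q hinj ν (tauWord Q u) (Pi.single ν 1) = Pi.single (ν.act w) 1 := by
  induction u generalizing w with
  | nil =>
    have : w = 1 := by simpa using hu.1.symm
    subst this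
    simp [tauWord, Weight.act_one]
  | cons l u ih =>
    obtain ⟨hu', hd⟩ := hu.of_cons
    have := ih hu'
    simp only [tauWord, List.map_cons, List.prod_cons] at this ⊢
    rw [map_mul, Module.End.mul_apply, this]
    funext μ
    rw [rep_tau, Pi.single_apply, Pi.single_apply, Weight.act_mul]
    by_cases hμ : μ = ν.act w
    · subst hμ
      rw [if_pos rfl, if_pos rfl, mul_one]
      exact if_pos ((prec_iff (hinj ν)).2 hd)
    · have h' : μ.act (simple l) ≠ (ν.act w).act (simple l) := fun h => hμ (by
        simpa using congrArg (Weight.act (simple l)) h)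
      simp [hμ, h']

variable {red : Equiv.Perm (Fin n) → List (Fin (n - 1))}
  (hred : ∀ w, IsReducedWord (red w) w)
include hred

theorem rep_stdElt_single [DecidableEq (Weight D n β)] (ν : Weight D n β)
    (w : Equiv.Perm (Fin n)) (f : MvPolynomial (Fin n) k) :
    rep Q hinj ν (stdElt Q red w f ν) (Pi.single ν 1) =
      Pi.single (ν.act w) (MvPolynomial.rename ν.1 f) := by
  have h : stdElt Q red w f ν =
      poly Q (MvPolynomial.rename w f) * tauWord Q (red w) * e Q ν := by
    rw [poly_mul_tauWord hinj, (hred w).1, MvPolynomial.rename_rename, ← Equiv.Perm.coe_mul,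
      inv_mul_cancel, Equiv.Perm.coe_one, MvPolynomial.rename_id_apply, stdElt]
  have he : rep Q hinj ν (e Q ν) (Pi.single ν 1) = Pi.single ν 1 := by
    funext μ
    rw [rep_e]
    split_ifs with hμ
    · rfl
    · simp [hμ]
  rw [h, map_mul, map_mul, Module.End.mul_apply, Module.End.mul_apply, he,
    rep_tauWord_single Q hinj ν (hred w)]
  funext μ
  rw [rep_poly]
  by_cases hμ : μ = ν.act w
  · subst hμ
    rw [Pi.single_eq_same, Pi.single_eq_same, mul_one, MvPolynomial.aeval_rename,
      ← MvPolynomial.aeval_X_left_apply (MvPolynomial.rename ν.1 f), MvPolynomial.aeval_rename]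
    congr 2
    funext t
    simp [Weight.act_apply]
  · simp [hμ]

variable (red) in
omit hinj hred in
open scoped Classical in
/-- The parametrization of `R_β` by families of polynomials. -/
noncomputable def pbwMap :
    (Weight D n β × Equiv.Perm (Fin n) → MvPolynomial (Fin n) k) →ₗ[k] KLR Q n β :=
  LinearMap.lsum k _ k fun p => stdMap Q red p.2 p.1

omit hinj hred in
theorem pbwMap_apply (F : Weight D n β × Equiv.Perm (Fin n) → MvPolynomial (Fin n) k) :
    pbwMap Q red F = ∑ p, stdElt Q red p.2 (F p) p.1 := by
  simp [pbwMap, LinearMap.lsum_apply, stdMap]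

omit hinj hred in
open scoped Classical in
theorem pbwMap_single
    (p : Weight D n β × Equiv.Perm (Fin n)) (f : MvPolynomial (Fin n) k) :
    pbwMap Q red (Pi.single p f) = stdElt Q red p.2 f p.1 := by
  rw [pbwMap, LinearMap.lsum_piSingle]
  rfl

/-- Right multiplication by `e(ν)` isolates ν. Applying the representation normalized by ν to the
delta family at ν then isolates `w`, because the weights `w.ν` are distinct, and leaves the
polynomial with variables renamed injectively. -/
theorem pbwMap_injective : Function.Injective (pbwMap (β := β) Q red) := by
  classical
  rw [injective_iff_map_eq_zero]
  intro F hF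
  funext ⟨ν, w⟩
  have h1 : ∑ v, stdElt Q red v (F (ν, v)) ν = 0 := by
    have := congrArg (· * e Q ν) hF
    simp only [pbwMap_apply, zero_mul, Finset.sum_mul, Fintype.sum_prod_type] at this
    rw [Finset.sum_eq_single ν (fun μ _ hμ => Finset.sum_eq_zero fun v _ =>
      stdElt_mul_e_ne Q v _ hμ) (by simp)] at this
    simpa only [stdElt_mul_e_self] using this
  have h2 := congrFun (congrArg (fun r => rep Q hinj ν r (Pi.single ν 1)) h1) (ν.act w)
  simp only [map_sum, LinearMap.sum_apply, rep_stdElt_single Q hinj hred, Finset.sum_apply,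
    map_zero, LinearMap.zero_apply, Pi.zero_apply] at h2
  rw [Finset.sum_eq_single w (fun v _ hv => Pi.single_eq_of_ne
    (fun h => hv (Weight.act_injective_left (hinj ν) h.symm)) _) (by simp), Pi.single_eq_same] at h2
  exact MvPolynomial.rename_injective _ (hinj ν) (by simpa using h2)

end KLR

end Representation
-- Triangular systems of polynomials with unit leading coefficients.
section Triangular

variable {k : Type*} [CommRing k] {n : ℕ}

open MvPolynomial

/-- In a vanishing combination, the largest leading exponent among the nonzero terms receives a
contribution from one term only. The unit coefficient makes this work over any commutative ring. -/
theorem linearIndependent_of_lead {κ : Type*} (f : κ → MvPolynomial (Fin n) k)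
    (lead : κ → Fin n →₀ ℕ) (hlead : Function.Injective lead)
    (hunit : ∀ a, IsUnit (coeff (lead a) (f a)))
    (hle : ∀ a, ∀ m ∈ (f a).support, toColex m ≤ toColex (lead a)) : LinearIndependent k f := by
  classical
  rw [linearIndependent_iff']
  intro s g hg
  by_contra! hne
  obtain ⟨b, hb, hgb⟩ := hne
  obtain ⟨a, ha, hmax⟩ := (s.filter fun a => g a ≠ 0).exists_max_image
    (fun a => toColex (lead a)) ⟨b, Finset.mem_filter.2 ⟨hb, hgb⟩⟩
  obtain ⟨has, hga⟩ := Finset.mem_filter.1 ha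
  have h := congrArg (coeff (lead a)) hg
  rw [coeff_sum, coeff_zero, Finset.sum_eq_single a] at h
  · rw [coeff_smul, smul_eq_mul] at h
    exact hga ((hunit a).mul_left_eq_zero.1 h)
  · intro c hc hca
    rw [coeff_smul, smul_eq_mul]
    by_cases hgc : g c = 0
    · rw [hgc, zero_mul]
    · by_contra hz
      have h1 := hle c (lead a) (mem_support_iff.2 (right_ne_zero_of_mul hz))
      have h2 := hmax c (Finset.mem_filter.2 ⟨hc, hgc⟩)
      exact hca (hlead (toColex.injective (le_antisymm h2 h1)))
  · exact fun h => absurd has h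

/-- The polynomials in `x_s` for `s ≤ r` whose degree in `x_r` is less than `N`. -/
noncomputable def below (k : Type*) [CommRing k] {n : ℕ} (r : Fin n) (N : ℕ) :
    Submodule k (MvPolynomial (Fin n) k) :=
  restrictSupport k {m | m r < N ∧ ∀ s, r < s → m s = 0}

theorem below_mono {r : Fin n} {N N' : ℕ} (h : N ≤ N') : below k r N ≤ below k r N' :=
  fun _ hf _ hm => ⟨(hf hm).1.trans_le h, (hf hm).2⟩

theorem monomial_mem_below {r : Fin n} {N : ℕ} {m : Fin n →₀ ℕ} (c : k)
    (h : m r < N ∧ ∀ s, r < s → m s = 0) : monomial m c ∈ below k r N := by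
  intro m' hm'
  have := support_monomial_subset hm'
  rw [Finset.mem_singleton] at this
  exact this ▸ h

theorem mul_mem_below {r : Fin n} {N N' : ℕ} {f g : MvPolynomial (Fin n) k}
    (hf : f ∈ below k r N) (hg : g ∈ below k r (N' + 1)) : f * g ∈ below k r (N + N') := by
  classical
  intro m hm
  obtain ⟨m₁, h₁, m₂, h₂, rfl⟩ := Finset.mem_add.1 (support_mul f g hm)
  have e₁ := hf h₁
  have e₂ := hg h₂
  refine ⟨?_, fun s hs => ?_⟩
  · have a₁ := e₁.1
    have a₂ := e₂.1
    simp only [Finsupp.add_apply]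
    omega
  · simp [e₁.2 s hs, e₂.2 s hs]

/-- `G` is a polynomial of degree `N` in `x_r` with invertible leading coefficient, whose other
coefficients are polynomials in `x_s` for `s < r`. -/
def IsTop (r : Fin n) (N : ℕ) (G : MvPolynomial (Fin n) k) : Prop :=
  ∃ u : k, IsUnit u ∧ ∃ f ∈ below k r N, G = monomial (Finsupp.single r N) u + f

theorem single_le_below (r : Fin n) (N : ℕ) (u : k) :
    monomial (Finsupp.single r N) u ∈ below k r (N + 1) :=
  monomial_mem_below _ ⟨by simp, fun s hs => by simp [hs.ne]⟩

theorem IsTop.mem_below {r : Fin n} {N : ℕ} {G : MvPolynomial (Fin n) k} (h : IsTop r N G) :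
    G ∈ below k r (N + 1) := by
  obtain ⟨u, -, f, hf, rfl⟩ := h
  exact add_mem (single_le_below r N u) (below_mono N.le_succ hf)

theorem IsTop.mul {r : Fin n} {N N' : ℕ} {G G' : MvPolynomial (Fin n) k} (h : IsTop r N G)
    (h' : IsTop r N' G') : IsTop r (N + N') (G * G') := by
  have hG' := h'.mem_below
  obtain ⟨u, hu, f, hf, rfl⟩ := h
  obtain ⟨u', hu', f', hf', rfl⟩ := h'
  refine ⟨u * u', hu.mul hu', f' * monomial (Finsupp.single r N) u + f * _, add_mem ?_
    (mul_mem_below hf hG'), ?_⟩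
  · rw [add_comm N]
    exact mul_mem_below hf' (single_le_below r N u)
  · rw [Finsupp.single_add, ← monomial_mul]
    ring

theorem isTop_one (r : Fin n) : IsTop r 0 (1 : MvPolynomial (Fin n) k) :=
  ⟨1, isUnit_one, 0, zero_mem _, by simp⟩

theorem isTop_prod {ι : Type*} (s : Finset ι) (r : Fin n) (N : ι → ℕ)
    (G : ι → MvPolynomial (Fin n) k) (h : ∀ i ∈ s, IsTop r (N i) (G i)) :
    IsTop r (∑ i ∈ s, N i) (∏ i ∈ s, G i) := by
  classical
  induction s using Finset.induction_on with
  | empty => exact isTop_one r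
  | insert a s ha ih =>
    rw [Finset.sum_insert ha, Finset.prod_insert ha]
    exact (h a (by simp)).mul (ih fun i hi => h i (by simp [hi]))

theorem isTop_aeval (r : Fin n) {p : Polynomial k} (hp : p.Monic) :
    IsTop r p.natDegree (Polynomial.aeval (X r : MvPolynomial (Fin n) k) p) := by
  refine ⟨1, isUnit_one, ∑ i ∈ Finset.range p.natDegree, p.coeff i • X r ^ i,
    Submodule.sum_mem _ fun i hi => Submodule.smul_mem _ _ ?_, ?_⟩
  · rw [X_pow_eq_monomial]
    exact monomial_mem_below _ ⟨by simpa using hi, fun s hs => by simp [hs.ne]⟩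
  · rw [Polynomial.aeval_eq_sum_range, Finset.sum_range_succ, hp.coeff_natDegree, one_smul,
      X_pow_eq_monomial, add_comm]

theorem toColex_lt_single {r : Fin n} {N : ℕ} {m : Fin n →₀ ℕ}
    (h : m r < N ∧ ∀ s, r < s → m s = 0) : toColex m < toColex (Finsupp.single r N) :=
  Finsupp.Colex.lt_iff.2 ⟨r, fun s hs => by simp [h.2 s hs, hs.ne], by simpa using h.1⟩

theorem monomial_mul_mul_mem (W : Submodule k (MvPolynomial (Fin n) k)) (d : Fin n →₀ ℕ)
    (f g : MvPolynomial (Fin n) k) (h : ∀ m ∈ f.support, monomial (d + m) 1 * g ∈ W) :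
    monomial d 1 * f * g ∈ W := by
  rw [f.as_sum, Finset.mul_sum, Finset.sum_mul]
  refine W.sum_mem fun m hm => ?_
  have : monomial d 1 * monomial m (coeff m f) * g = coeff m f • (monomial (d + m) 1 * g) := by
    rw [monomial_mul, one_mul, ← smul_mul_assoc, smul_monomial, smul_eq_mul, mul_one]
  rw [this]
  exact W.smul_mem _ (h m hm)

variable {N : Fin n → ℕ} {G : Fin n → MvPolynomial (Fin n) k}

variable (k N) in
/-- The monomials `x^c` with `c_t < N_t` for all `t`. -/
noncomputable def smallMonomial (c : {c : Fin n → ℕ // ∀ t, c t < N t}) : MvPolynomial (Fin n) k :=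
  monomial (Finsupp.equivFunOnFinite.symm c.1) 1

variable (N G) in
/-- The multiples `x^c G_r` with `c_t < N_t` for all `t > r`. -/
noncomputable def smallMultiple (p : {p : (Fin n → ℕ) × Fin n // ∀ t, p.2 < t → p.1 t < N t}) :
    MvPolynomial (Fin n) k :=
  monomial (Finsupp.equivFunOnFinite.symm p.1.1) 1 * G p.1.2

/-- In the colexicographic order the leading exponents are `c` and `c + N_r` at place `r`. They are
all distinct: for a multiple, `r` is recovered as the largest `t` whose exponent is at least `N_t`;
for a small monomial there is no such `t`. -/
theorem linearIndependent_small (hG : ∀ r, IsTop r (N r) (G r)) :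
    LinearIndependent k (Sum.elim (smallMonomial k N) (smallMultiple N G)) := by
  classical
  have inj := (Finsupp.equivFunOnFinite (α := Fin n) (M := ℕ)).symm.injective
  refine linearIndependent_of_lead _ (Sum.elim (fun c => Finsupp.equivFunOnFinite.symm c.1)
    fun p => Finsupp.equivFunOnFinite.symm p.1.1 + Finsupp.single p.1.2 (N p.1.2)) ?_ ?_ ?_
  · rintro (⟨c, hc⟩ | ⟨⟨c, r⟩, hc⟩) (⟨c', hc'⟩ | ⟨⟨c', r'⟩, hc'⟩) h <;>
      simp only [Sum.elim_inl, Sum.elim_inr] at h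
    · rw [Sum.inl.injEq, Subtype.mk.injEq]
      exact inj h
    · have h1 := DFunLike.congr_fun h r'
      have h2 := hc r'
      simp at h1
      omega
    · have h1 := DFunLike.congr_fun h r
      have h2 := hc' r
      simp at h1
      omega
    · rcases lt_trichotomy r r' with hr | rfl | hr
      · have h1 := DFunLike.congr_fun h r'
        have h2 := hc r' hr
        simp [hr.ne] at h1 h2
        omega
      · rw [Sum.inr.injEq, Subtype.mk.injEq, Prod.mk.injEq]
        exact ⟨inj (add_right_cancel h), rfl⟩
      · have h1 := DFunLike.congr_fun h r
        have h2 := hc' r hr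
        simp [hr.ne] at h1 h2
        omega
  · rintro (⟨c, hc⟩ | ⟨⟨c, r⟩, hc⟩)
    · simp [smallMonomial]
    · obtain ⟨u, hu, f, hf, hGr⟩ := hG r
      have : coeff (Finsupp.single r (N r)) f = 0 := by
        rw [← notMem_support_iff]
        intro h
        simpa using (hf h).1
      simp only [Sum.elim_inr, smallMultiple]
      rwa [coeff_monomial_mul, one_mul, hGr, coeff_add, this, add_zero, coeff_monomial, if_pos rfl]
  · rintro (⟨c, hc⟩ | ⟨⟨c, r⟩, hc⟩) m hm
    · have := support_monomial_subset hm
      rw [Finset.mem_singleton] at this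
      rw [this]; rfl
    · obtain ⟨u, hu, f, hf, hGr⟩ := hG r
      simp only [Sum.elim_inr, smallMultiple] at hm ⊢
      obtain ⟨m₁, h₁, m₂, h₂, rfl⟩ := Finset.mem_add.1 (support_mul _ _ hm)
      have h₁ := support_monomial_subset h₁
      rw [Finset.mem_singleton] at h₁
      subst h₁
      rw [toColex_add, toColex_add]
      refine add_le_add_right ?_ _
      rw [hGr] at h₂
      rcases Finset.mem_union.1 (support_add h₂) with h | h
      · have := support_monomial_subset h
        rw [Finset.mem_singleton] at this
        rw [this]
      · exact (toColex_lt_single (hf h)).le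

theorem smul_monomial_eq {r : Fin n} {M : ℕ} {u : k} {f H : MvPolynomial (Fin n) k}
    (h : H = monomial (Finsupp.single r M) u + f) {d : Fin n →₀ ℕ} (hd : M ≤ d r) :
    u • monomial d (1 : k) = monomial (d - Finsupp.single r M) 1 * H -
      monomial (d - Finsupp.single r M) 1 * f := by
  rw [h, mul_add, add_sub_cancel_right, monomial_mul, tsub_add_cancel_of_le
    (Finsupp.single_le_iff.2 hd), smul_monomial, one_mul, smul_eq_mul, mul_one]

theorem toColex_sub_add_lt {r : Fin n} {M : ℕ} {m d : Fin n →₀ ℕ} (hd : M ≤ d r)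
    (h : m r < M ∧ ∀ s, r < s → m s = 0) :
    toColex (d - Finsupp.single r M + m) < toColex d := by
  conv_rhs => rw [← tsub_add_cancel_of_le (Finsupp.single_le_iff.2 hd)]
  rw [toColex_add, toColex_add]
  exact add_lt_add_right (toColex_lt_single h) _

/-- If `x^d G_r` is not small, let `t > r` be the largest place with `d_t ≥ N_t` and replace
`x_t^{N_t}`, up to a unit, by `G_t` minus lower terms. The lower terms decrease `d`
colexicographically and fall to induction. -/
theorem monomial_mul_mem_span (hG : ∀ r, IsTop r (N r) (G r)) (d : Fin n →₀ ℕ) (r : Fin n) :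
    monomial d 1 * G r ∈ Submodule.span k (Set.range (smallMultiple N G)) := by
  have := Finsupp.Colex.wellFoundedLT_of_finite (α := Fin n) (N := ℕ)
  induction hd : toColex d using WellFoundedLT.induction generalizing d r with
  | _ x ih =>
  subst hd
  by_cases hr : ∀ t, r < t → d t < N t
  · refine Submodule.subset_span ⟨⟨(d, r), hr⟩, ?_⟩
    simp [smallMultiple]
  · push Not at hr
    obtain ⟨t₀, h₀⟩ := hr
    obtain ⟨t, ht, hmax⟩ := (Finset.univ.filter fun t => r < t ∧ N t ≤ d t).exists_max_image id
      ⟨t₀, by simpa using h₀⟩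
    simp only [Finset.mem_filter, Finset.mem_univ, true_and, id] at ht hmax
    obtain ⟨u, hu, f, hf, hGt⟩ := hG t
    rw [← Submodule.smul_mem_iff_of_isUnit _ hu, ← smul_mul_assoc, smul_monomial_eq hGt ht.2,
      sub_mul]
    refine sub_mem ?_ (monomial_mul_mul_mem _ _ _ _ fun m hm =>
      ih _ (toColex_sub_add_lt ht.2 (hf hm)) _ _ rfl)
    -- In the term containing `G_t G_r` the roles are exchanged and `G_r` is expanded. It involves
    -- only `x_s` with `s ≤ r < t`, so the exponents beyond `t` are unchanged, hence small by
    -- maximality of `t`.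
    rw [mul_assoc, mul_comm (G t), ← mul_assoc]
    refine monomial_mul_mul_mem _ _ _ _ fun m hm => Submodule.subset_span
      ⟨⟨(⇑(d - Finsupp.single t (N t) + m), t), fun s hs => ?_⟩, by
        rw [smallMultiple, Finsupp.equivFunOnFinite_symm_coe]⟩
    have h1 : m s = 0 := ((hG r).mem_below hm).2 s (ht.1.trans hs)
    have h2 : ¬ N s ≤ d s := fun h => (hmax s ⟨ht.1.trans hs, h⟩).not_gt hs
    simp [h1, hs.ne]
    omega

theorem mul_mem_span (hG : ∀ r, IsTop r (N r) (G r)) (f : MvPolynomial (Fin n) k) (r : Fin n) :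
    f * G r ∈ Submodule.span k (Set.range (smallMultiple N G)) := by
  have := monomial_mul_mul_mem (Submodule.span k (Set.range (smallMultiple N G))) 0 f (G r)
    fun m _ => monomial_mul_mem_span hG _ r
  simpa using this

theorem ideal_span_eq (hG : ∀ r, IsTop r (N r) (G r)) :
    (Ideal.span (Set.range G)).restrictScalars k =
      Submodule.span k (Set.range (smallMultiple N G)) := by
  refine le_antisymm (fun f hf => ?_) (Submodule.span_le.2 ?_)
  · obtain ⟨c, rfl⟩ := Ideal.mem_span_range_iff_exists_fun.1 hf
    exact Submodule.sum_mem _ fun r _ => mul_mem_span hG _ r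
  · rintro _ ⟨p, rfl⟩
    exact Ideal.mul_mem_left _ _ (Ideal.subset_span ⟨p.1.2, rfl⟩)

/-- Division with remainder: a power `x_t^{N_t}` in a monomial is traded for `G_t` and
colexicographically smaller monomials. -/
theorem mem_span_small_sup (hG : ∀ r, IsTop r (N r) (G r)) (f : MvPolynomial (Fin n) k) :
    f ∈ Submodule.span k (Set.range (smallMonomial k N)) ⊔
      Submodule.span k (Set.range (smallMultiple N G)) := by
  have := Finsupp.Colex.wellFoundedLT_of_finite (α := Fin n) (N := ℕ)
  set W := Submodule.span k (Set.range (smallMonomial k N)) ⊔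
      Submodule.span k (Set.range (smallMultiple N G))
  have key : ∀ d : Fin n →₀ ℕ, monomial d (1 : k) ∈ W := by
    intro d
    induction hd : toColex d using WellFoundedLT.induction generalizing d with
    | _ x ih =>
    subst hd
    by_cases hr : ∀ t, d t < N t
    · exact Submodule.mem_sup_left (Submodule.subset_span ⟨⟨d, hr⟩, by simp [smallMonomial]⟩)
    · push Not at hr
      obtain ⟨t, ht⟩ := hr
      obtain ⟨u, hu, f, hf, hGt⟩ := hG t
      rw [← Submodule.smul_mem_iff_of_isUnit _ hu, smul_monomial_eq hGt ht]
      refine sub_mem (Submodule.mem_sup_right (mul_mem_span hG _ t)) ?_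
      have := monomial_mul_mul_mem W (d - Finsupp.single t (N t)) f 1 fun m hm => by
        rw [mul_one]
        exact ih _ (toColex_sub_add_lt ht (hf hm)) _ rfl
      rwa [mul_one] at this
  have := monomial_mul_mul_mem W 0 f 1 fun m _ => by
    rw [mul_one]
    exact key _
  simpa using this

end Triangular

/-! ### Degrees of the `Q_{ij}` and the product formula for the `g` polynomials. -/

section Cyclotomic

variable {I P k : Type*} [AddCommGroup P] [CommRing k] {D : CartanDatum I P}
  {A : ℕ → AddSubgroup k} {L : P} (Q : QMatrix D A) (a : CyclotomicPolys D A L) {n : ℕ} {β : P}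

open MvPolynomial

/-- A nonzero coefficient has nonnegative degree, which after halving reads `d_i p + d_j q ≤ -d_j
a_{ji}`. -/
theorem QMatrix.degree_le {i j : I} (hij : i ≠ j) {p q : ℕ} (h : coeffUV (Q.Q i j) p q ≠ 0) :
    q < (-D.a j i).toNat ∨ q = (-D.a j i).toNat ∧ p = 0 := by
  have h0 : 0 ≤ -2 * D.form i j - D.form i i * p - D.form j j * q := by
    by_contra hneg
    have := Q.homogeneous i j hij p q
    rw [piece, if_neg hneg] at this
    exact h (AddSubgroup.mem_bot.1 this)
  simp only [CartanDatum.form, D.a_diag, D.d_symm i j] at h0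
  have hi := D.d_pos i
  have hj := D.d_pos j
  have ha := D.a_nonpos j i hij.symm
  have h1 : D.d i * p ≤ D.d j * (-D.a j i - q) := by linarith
  have h2 : 0 ≤ -D.a j i - (q : ℤ) := by
    by_contra hneg
    have : 0 ≤ D.d i * (p : ℤ) := by positivity
    have : D.d j * (-D.a j i - q) < 0 := mul_neg_of_pos_of_neg hj (not_le.1 hneg)
    linarith
  rcases h2.eq_or_lt with h3 | h3
  · right
    rw [← h3, mul_zero] at h1
    refine ⟨by omega, ?_⟩
    by_contra hp
    have : 0 < D.d i * (p : ℤ) := mul_pos hi (by omega)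
    linarith
  · left; omega

theorem QMatrix.isUnit_coeff_right {i j : I} (hij : i ≠ j) :
    IsUnit (coeffUV (Q.Q i j) 0 (-D.a j i).toNat) := by
  have h := Q.isUnit_coeff j i hij.symm
  rw [Q.symm j i, coeffUV] at h
  rw [coeffUV]
  convert h using 1
  rw [← MvPolynomial.coeff_rename_mapDomain (Equiv.swap (0 : Fin 2) 1) (Equiv.injective _)]
  simp [Finsupp.mapDomain_single]

/-- By `degree_le` the only monomial with top power of the second variable is that pure power, whose
coefficient is a unit by symmetry of `Q`. -/
theorem QMatrix.isTop_at {i j : I} (hij : i ≠ j) {s r : Fin n} (hs : s < r) :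
    IsTop r (-D.a j i).toNat (Q.at i j s r) := by
  set M := (-D.a j i).toNat
  set u := coeffUV (Q.Q i j) 0 M
  refine ⟨u, Q.isUnit_coeff_right hij,
    aeval ![X s, X r] (Q.Q i j - monomial (Finsupp.single 1 M) u), ?_, ?_⟩
  · rw [aeval_def, eval₂_eq']
    refine Submodule.sum_mem _ fun m hm => ?_
    have hm1 : m 1 < M := by
      have hsum : m = Finsupp.single 0 (m 0) + Finsupp.single 1 (m 1) := by
        ext t; fin_cases t <;> simp
      by_contra hlt
      rw [mem_support_iff, coeff_sub, coeff_monomial] at hm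
      have hne : coeff m (Q.Q i j) ≠ 0 ∨ Finsupp.single 1 M = m := by
        by_contra! h; simp [h] at hm
      have hm' : m = Finsupp.single 1 M := by
        rcases hne with h | h
        · rw [hsum] at h
          obtain h | ⟨h1, h2⟩ := Q.degree_le hij h
          · exact absurd h hlt
          · rw [hsum, h1, h2]; simp [M]
        · exact h.symm
      rw [if_pos hm'.symm] at hm
      apply hm
      simp [u, coeffUV, hm']
    rw [← Algebra.smul_def]
    refine Submodule.smul_mem _ _ ?_
    rw [Fin.prod_univ_two]
    simp only [Matrix.cons_val_zero, Matrix.cons_val_one, X_pow_eq_monomial, monomial_mul]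
    exact monomial_mem_below _ ⟨by simpa [hs.ne] using hm1,
      fun t ht => by simp [ht.ne, (hs.trans ht).ne]⟩
  · rw [map_sub, aeval_monomial, QMatrix.at]
    simp [algebraMap_eq, C_mul_X_pow_eq_monomial]

/-- The product formula for the polynomials `g^Λ_{w,ν,r}`. -/
noncomputable def gProd (w : Equiv.Perm (Fin n)) (ν : Weight D n β) (r : Fin n) :
    MvPolynomial (Fin n) k :=
  Polynomial.aeval (X r) (a.poly (ν.1 r)) *
    ∏ s : Fin n with s < r ∧ w s < w r, Q.at (ν.1 s) (ν.1 r) s r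

theorem rename_gProd_lo (w : Equiv.Perm (Fin n)) (ν : Weight D n β) (l : Fin (n - 1)) :
    rename (simple l) (gProd Q a (w * simple l) (ν.act (simple l)) (lo l)) =
      Polynomial.aeval (X (hi l)) (a.poly (ν.1 (hi l))) *
        ∏ s : Fin n with s < lo l ∧ w s < w (hi l), Q.at (ν.1 s) (ν.1 (hi l)) s (hi l) := by
  have key : ∀ s, s < lo l → simple l s = s := fun s hs =>
    simple_of_ne hs.ne (hs.trans (lo_lt_hi l)).ne
  rw [gProd, map_mul, map_prod, ← Polynomial.aeval_algHom_apply, rename_X]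
  simp only [QMatrix.rename_at, Weight.act_apply, simple_inv, simple_lo, Equiv.Perm.mul_apply]
  congr 1
  refine Finset.prod_congr (Finset.filter_congr fun s _ => and_congr_right fun hs => ?_)
    fun s hs => ?_
  · rw [key s hs]
  · rw [key s (Finset.mem_filter.1 hs).2.1]

theorem lt_hi_iff (l : Fin (n - 1)) (s : Fin n) : s < hi l ↔ s = lo l ∨ s < lo l := by
  simp only [Fin.lt_def, Fin.ext_iff, lo, hi]
  omega

theorem gProd_hi_of_lt {w : Equiv.Perm (Fin n)} {l : Fin (n - 1)} (h : w (lo l) < w (hi l))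
    (ν : Weight D n β) : gProd Q a w ν (hi l) =
      rename (simple l) (gProd Q a (w * simple l) (ν.act (simple l)) (lo l)) *
        Q.at (ν.1 (lo l)) (ν.1 (hi l)) (lo l) (hi l) := by
  have hfil : (Finset.univ.filter fun s => s < hi l ∧ w s < w (hi l)) =
      insert (lo l) (Finset.univ.filter fun s => s < lo l ∧ w s < w (hi l)) := by
    ext s
    simp only [Finset.mem_filter, Finset.mem_univ, true_and, Finset.mem_insert, lt_hi_iff]
    constructor
    · rintro ⟨h1 | h1, h2⟩
      · exact Or.inl h1
      · exact Or.inr ⟨h1, h2⟩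
    · rintro (rfl | ⟨h1, h2⟩)
      · exact ⟨Or.inl rfl, h⟩
      · exact ⟨Or.inr h1, h2⟩
  rw [rename_gProd_lo, gProd, hfil, Finset.prod_insert (by simp)]
  ring

theorem gProd_hi_of_gt {w : Equiv.Perm (Fin n)} {l : Fin (n - 1)} (h : w (hi l) < w (lo l))
    (ν : Weight D n β) : gProd Q a w ν (hi l) =
      rename (simple l) (gProd Q a (w * simple l) (ν.act (simple l)) (lo l)) := by
  rw [rename_gProd_lo, gProd]
  congr 1
  refine Finset.prod_congr (Finset.filter_congr fun s _ => ?_) fun _ _ => rfl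
  rw [lt_hi_iff]
  constructor
  · rintro ⟨rfl | h1, h2⟩
    · exact absurd h2 h.not_gt
    · exact ⟨h1, h2⟩
  · rintro ⟨h1, h2⟩
    exact ⟨Or.inr h1, h2⟩

variable (hinj : ∀ ν : Weight D n β, Function.Injective ν.1)
include hinj

/-- The recursion keeps `w.ν` fixed while ν becomes `s_l.ν`, so `w` becomes `w s_l`; hence the
induction over all `w` and ν. The test on the order of the entries is then the test whether `l` is
an ascent of `w`, and the branch for equal entries never occurs. -/
theorem gPoly_eq_gProd (r : ℕ) (h : r < n) (w : Equiv.Perm (Fin n)) (ν : Weight D n β) :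
    gPoly Q a (ν.act w).1 r h ν.1 = gProd Q a w ν ⟨r, h⟩ := by
  induction r generalizing w ν with
  | zero =>
    rw [gPoly, gProd, Finset.prod_eq_one, mul_one]
    intro s hs
    exact absurd (Fin.lt_def.1 (Finset.mem_filter.1 hs).2.1) (Nat.not_lt_zero _)
  | succ r ih =>
    have hrn : r < n := Nat.lt_of_succ_lt h
    let l : Fin (n - 1) := ⟨r, by omega⟩
    have hp : (⟨r, hrn⟩ : Fin n) = lo l := rfl
    have hq : (⟨r + 1, h⟩ : Fin n) = hi l := rfl
    have hprec : Prec (ν.act w).1 (ν.1 (hi l)) (ν.1 (lo l)) ↔ w (hi l) < w (lo l) := by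
      have := prec_iff (hinj (ν.act w)) (s := w (hi l)) (t := w (lo l))
      simpa [Weight.act_apply] using this
    have hg : gPoly Q a (ν.act w).1 r hrn (ν.1 ∘ Equiv.swap (lo l) (hi l)) =
        gProd Q a (w * simple l) (ν.act (simple l)) (lo l) := by
      have e1 : ν.1 ∘ Equiv.swap (lo l) (hi l) = (ν.act (simple l)).1 := by
        funext t
        rw [Weight.act_apply, simple_inv]
        rfl
      have e2 : (ν.act w).1 = ((ν.act (simple l)).act (w * simple l)).1 := by
        rw [← Weight.act_mul, mul_simple_mul_simple]
      rw [e1, e2, ih, hp]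
    rw [gPoly]
    simp only [hp, hq]
    refine (if_neg fun h => lo_ne_hi l (hinj ν h)).trans ?_
    rw [hg]
    rcases ascent_or_descent w l with hw | hw
    · refine (if_neg (mt hprec.1 hw.not_gt)).trans ?_
      rw [gProd_hi_of_lt Q a hw]
      rfl
    · refine (if_pos (hprec.2 hw)).trans ?_
      rw [gProd_hi_of_gt Q a hw]
      rfl

theorem gw_eq_gProd (w : Equiv.Perm (Fin n)) (ν : Weight D n β) (r : Fin n) :
    gw Q a w ν r = gProd Q a w ν r :=
  gPoly_eq_gProd Q a hinj r.1 r.2 w ν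

omit hinj in
theorem gProd_zero (w : Equiv.Perm (Fin n)) (ν : Weight D n β) {r : Fin n} (hr : r.1 = 0) :
    gProd Q a w ν r = Polynomial.aeval (X r) (a.poly (ν.1 r)) := by
  rw [gProd, Finset.prod_eq_one, mul_one]
  intro s hs
  exact absurd (Fin.lt_def.1 (Finset.mem_filter.1 hs).2.1) (hr ▸ Nat.not_lt_zero _)

variable (L) in
omit hinj in
/-- The bound on the exponents, as a natural number. -/
def natBound (D : CartanDatum I P) (w : Equiv.Perm (Fin n)) (ν : Weight D n β) (t : Fin n) : ℕ :=
  (bound D L w ν t).toNat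

/-- Degrees in `x_r` add over the factors, each `Q` giving `-a_{ν_r,ν_s} ≥ 0`. So the integral bound
is nonnegative and `toNat` loses nothing. -/
theorem isTop_gProd (w : Equiv.Perm (Fin n)) (ν : Weight D n β) (r : Fin n) :
    IsTop r (natBound L D w ν r) (gProd Q a w ν r) ∧
      (natBound L D w ν r : ℤ) = bound D L w ν r := by
  have hne : ∀ s, s < r → ν.1 s ≠ ν.1 r := fun s hs h => hs.ne (hinj ν h)
  have h := (isTop_aeval (k := k) r (a.monic (ν.1 r))).mul
    (isTop_prod (Finset.univ.filter fun s => s < r ∧ w s < w r) r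
      (fun s => (-D.a (ν.1 r) (ν.1 s)).toNat) (fun s => Q.at (ν.1 s) (ν.1 r) s r)
      fun s hs => Q.isTop_at (hne s (Finset.mem_filter.1 hs).2.1) (Finset.mem_filter.1 hs).2.1)
  have hb : bound D L w ν r = (((a.poly (ν.1 r)).natDegree +
      ∑ s : Fin n with s < r ∧ w s < w r, (-D.a (ν.1 r) (ν.1 s)).toNat : ℕ) : ℤ) := by
    rw [bound, ← a.natDegree_eq, sub_eq_add_neg, ← Finset.sum_neg_distrib]
    push_cast
    congr 1
    refine Finset.sum_congr rfl fun s hs => ?_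
    have := D.a_nonpos _ _ (hne s (Finset.mem_filter.1 hs).2.1).symm
    omega
  rw [natBound, hb, Int.toNat_natCast]
  exact ⟨h, rfl⟩

end Cyclotomic
-- The cyclotomic ideal in terms of the ideals generated by the `g` polynomials.
section CyclotomicIdeal

variable {I P k : Type*} [AddCommGroup P] [CommRing k] {D : CartanDatum I P}
  {A : ℕ → AddSubgroup k} {L : P} (Q : QMatrix D A) (a : CyclotomicPolys D A L) {n : ℕ} {β : P}

open MvPolynomial

theorem mul_map_mem_of_mem_span {R S ι : Type*} [CommRing R] [CommRing S] (φ : R →+* S) (q : S)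
    (g : ι → R) (J : Ideal S) (h : ∀ i, q * φ (g i) ∈ J) {f : R}
    (hf : f ∈ Ideal.span (Set.range g)) : q * φ f ∈ J := by
  induction hf using Submodule.span_induction with
  | mem f hf => obtain ⟨i, rfl⟩ := hf; exact h i
  | zero => rw [map_zero, mul_zero]; exact J.zero_mem
  | add x y _ _ hx hy => rw [map_add, mul_add]; exact J.add_mem hx hy
  | smul c x _ hx =>
    rw [smul_eq_mul, map_mul, mul_left_comm]
    exact J.mul_mem_left _ hx

/-- The polynomial `a^Λ_{ν_r}(x_r) ∏_{s ∈ S} Q_{ν_s,ν_r}(x_s, x_r)`. -/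
noncomputable def gSet (ν : Weight D n β) (r : Fin n) (S : Finset (Fin n)) :
    MvPolynomial (Fin n) k :=
  Polynomial.aeval (X r) (a.poly (ν.1 r)) * ∏ s ∈ S, Q.at (ν.1 s) (ν.1 r) s r

theorem gSet_dvd_gSet (ν : Weight D n β) (r : Fin n) {S S' : Finset (Fin n)} (h : S' ⊆ S) :
    gSet Q a ν r S' ∣ gSet Q a ν r S :=
  mul_dvd_mul_left _ (Finset.prod_dvd_prod_of_subset _ _ _ h)

/-- `S'` can exceed `S` only by `b`, and only for `r = c`; the extra `Q` is exactly the factor then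
missing. -/
theorem gSet_dvd_mul_gSet (ν : Weight D n β) {b c r : Fin n} {S S' : Finset (Fin n)}
    (h : ∀ s ∈ S', s ∈ S ∨ s = b ∧ r = c) :
    gSet Q a ν r S' ∣ Q.at (ν.1 b) (ν.1 c) b c * gSet Q a ν r S := by
  by_cases hS : S' ⊆ S
  · exact (gSet_dvd_gSet Q a ν r hS).mul_left _
  · obtain ⟨s, hs, hsS⟩ := Finset.not_subset.1 hS
    obtain ⟨rfl, rfl⟩ := (h s hs).resolve_left hsS
    have hins := Finset.prod_insert (f := fun s => Q.at (ν.1 s) (ν.1 r) s r) hsS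
    rw [gSet, gSet, mul_left_comm, ← hins]
    refine mul_dvd_mul_left _ (Finset.prod_dvd_prod_of_subset _ _ _ fun t ht => ?_)
    rcases h t ht with h | h
    · exact Finset.mem_insert_of_mem h
    · rw [h.1]; exact Finset.mem_insert_self _ _

theorem rename_gProd (w : Equiv.Perm (Fin n)) (ν : Weight D n β) (l : Fin (n - 1)) (r : Fin n) :
    rename (simple l) (gProd Q a w ν r) = gSet Q a (ν.act (simple l)) (simple l r)
      (Finset.univ.filter fun s => simple l s < r ∧ (w * simple l) s < w r) := by
  rw [gProd, map_mul, map_prod, gSet, ← Polynomial.aeval_algHom_apply, rename_X]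
  simp only [Weight.act_apply, simple_inv, simple_simple]
  congr 1
  refine Finset.prod_bij' (fun s _ => simple l s) (fun s _ => simple l s) ?_ ?_ ?_ ?_ ?_
  · intro s hs
    refine Finset.mem_filter.2 ⟨Finset.mem_univ _, ?_⟩
    simpa using (Finset.mem_filter.1 hs).2
  · intro s hs
    refine Finset.mem_filter.2 ⟨Finset.mem_univ _, ?_⟩
    simpa using (Finset.mem_filter.1 hs).2
  · simp
  · simp
  · simp [QMatrix.rename_at]

theorem inv_apply_hi {w : Equiv.Perm (Fin n)} {l : Fin (n - 1)} {s : Fin n}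
    (h : simple l (w s) = lo l) : w⁻¹ (hi l) = s := by
  rw [Equiv.Perm.inv_eq_iff_eq, ← simple_lo, ← h, simple_simple]

theorem inv_apply_lo {w : Equiv.Perm (Fin n)} {l : Fin (n - 1)} {s : Fin n}
    (h : simple l (w s) = hi l) : w⁻¹ (lo l) = s := by
  rw [Equiv.Perm.inv_eq_iff_eq, ← simple_hi, ← h, simple_simple]

/-- The ideal generated by the polynomials `g^Λ_{w,ν,r}`. -/
noncomputable def gIdeal (w : Equiv.Perm (Fin n)) (ν : Weight D n β) :
    Ideal (MvPolynomial (Fin n) k) :=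
  Ideal.span (Set.range (gProd Q a w ν))

variable {Q a}

theorem gIdeal_mem_of_dvd {w : Equiv.Perm (Fin n)} {ν : Weight D n β} {r : Fin n}
    {f : MvPolynomial (Fin n) k} (h : gProd Q a w ν r ∣ f) : f ∈ gIdeal Q a w ν :=
  Ideal.mem_of_dvd _ h (Ideal.subset_span ⟨r, rfl⟩)

/-- `s_l w` has one inversion more, so its products have fewer factors and divide those of `w`. -/
theorem gIdeal_simple_mul_of_lt {w : Equiv.Perm (Fin n)} {l : Fin (n - 1)}
    (h : w⁻¹ (lo l) < w⁻¹ (hi l)) {ν : Weight D n β} {f : MvPolynomial (Fin n) k}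
    (hf : f ∈ gIdeal Q a w ν) : f ∈ gIdeal Q a (simple l * w) ν := by
  have := mul_map_mem_of_mem_span (RingHom.id _) 1 _ (gIdeal Q a (simple l * w) ν)
    (fun r => ?_) hf
  · simpa using this
  rw [RingHom.id_apply, one_mul]
  refine gIdeal_mem_of_dvd (r := r) (gSet_dvd_gSet Q a ν r fun s hs => ?_)
  replace hs := (Finset.mem_filter.1 hs).2
  simp only [Equiv.Perm.mul_apply] at hs
  refine Finset.mem_filter.2 ⟨Finset.mem_univ _, hs.1, ?_⟩
  have := simple_lt_simple (l := l) hs.2 (by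
    rintro ⟨h1, h2⟩
    rw [inv_apply_hi h1, inv_apply_lo h2] at h
    exact h.not_gt hs.1)
  simpa using this

/-- When `l` is a left descent of `w`, `s_l w` gains a single non-inversion, the positions that `w`
sends to `hi l` and `lo l`. The factor `Q` that `τ_l²` produces belongs to this very pair. -/
theorem gIdeal_simple_mul_of_gt {w : Equiv.Perm (Fin n)} {l : Fin (n - 1)}
    {ν : Weight D n β} {f : MvPolynomial (Fin n) k} (hf : f ∈ gIdeal Q a w ν) :
    Q.at (ν.1 (w⁻¹ (hi l))) (ν.1 (w⁻¹ (lo l))) (w⁻¹ (hi l)) (w⁻¹ (lo l)) * f ∈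
      gIdeal Q a (simple l * w) ν := by
  refine mul_map_mem_of_mem_span (RingHom.id _) _ _ (gIdeal Q a (simple l * w) ν)
    (fun r => ?_) hf
  rw [RingHom.id_apply]
  refine gIdeal_mem_of_dvd (r := r) (gSet_dvd_mul_gSet Q a ν fun s hs => ?_)
  replace hs := (Finset.mem_filter.1 hs).2
  simp only [Equiv.Perm.mul_apply] at hs
  by_cases hne : simple l (w s) = lo l ∧ simple l (w r) = hi l
  · right
    obtain ⟨h1, h2⟩ := hne
    exact ⟨(inv_apply_hi h1).symm, (inv_apply_lo h2).symm⟩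
  · left
    exact Finset.mem_filter.2 ⟨Finset.mem_univ _, hs.1, by simpa using simple_lt_simple hs.2 hne⟩

theorem gIdeal_mul_simple_of_lt {w : Equiv.Perm (Fin n)} {l : Fin (n - 1)}
    (h : w (lo l) < w (hi l)) {ν : Weight D n β} {f : MvPolynomial (Fin n) k}
    (hf : f ∈ gIdeal Q a w ν) :
    rename (simple l) f ∈ gIdeal Q a (w * simple l) (ν.act (simple l)) := by
  have := mul_map_mem_of_mem_span (rename (simple l)).toRingHom 1 _
    (gIdeal Q a (w * simple l) (ν.act (simple l))) (fun r => ?_) hf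
  · simpa using this
  rw [one_mul]
  change rename (simple l) _ ∈ _
  rw [rename_gProd]
  refine gIdeal_mem_of_dvd (r := simple l r) (gSet_dvd_gSet Q a _ _ fun s hs => ?_)
  replace hs := (Finset.mem_filter.1 hs).2
  simp only [Equiv.Perm.mul_apply, simple_simple] at hs
  refine Finset.mem_filter.2 ⟨Finset.mem_univ _, ?_, hs.2⟩
  have := simple_lt_simple (l := l) hs.1 (by
    rintro ⟨rfl, h2⟩
    have e2 : r = lo l := by rw [← simple_simple l r, h2, simple_hi]
    rw [simple_lo, e2] at hs
    exact h.not_gt hs.2)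
  simpa using this

/-- When `l` is a descent of `w`, the pair `(lo l, hi l)` becomes a non-inversion of `w s_l`, and
the `Q` produced by right multiplication by `τ_l` is its factor. -/
theorem gIdeal_mul_simple_of_gt {w : Equiv.Perm (Fin n)} {l : Fin (n - 1)}
    {ν : Weight D n β} {f : MvPolynomial (Fin n) k} (hf : f ∈ gIdeal Q a w ν) :
    Q.at (ν.1 (hi l)) (ν.1 (lo l)) (lo l) (hi l) * rename (simple l) f ∈
      gIdeal Q a (w * simple l) (ν.act (simple l)) := by
  refine mul_map_mem_of_mem_span (rename (simple l)).toRingHom _ _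
    (gIdeal Q a (w * simple l) (ν.act (simple l))) (fun r => ?_) hf
  change _ * rename (simple l) _ ∈ _
  rw [rename_gProd]
  have key : Q.at (ν.1 (hi l)) (ν.1 (lo l)) (lo l) (hi l) =
      Q.at ((ν.act (simple l)).1 (lo l)) ((ν.act (simple l)).1 (hi l)) (lo l) (hi l) := by
    simp [Weight.act_apply]
  rw [key]
  refine gIdeal_mem_of_dvd (r := simple l r) (gSet_dvd_mul_gSet Q a _ fun s hs => ?_)
  replace hs := (Finset.mem_filter.1 hs).2
  simp only [Equiv.Perm.mul_apply, simple_simple] at hs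
  by_cases hne : s = lo l ∧ simple l r = hi l
  · exact Or.inr hne
  · exact Or.inl (Finset.mem_filter.2
      ⟨Finset.mem_univ _, by simpa using simple_lt_simple hs.1 hne, hs.2⟩)

variable [Module.Finite ℤ P]

namespace KLR

variable {red : Equiv.Perm (Fin n) → List (Fin (n - 1))}

variable (Q a red) in
/-- The span of the elements `τ_w f(x_1, …, x_n) e(ν)` with `f` in the ideal generated by the
`g^Λ_{w,ν,r}`. -/
noncomputable def gSpan : Submodule k (KLR Q n β) :=
  Submodule.span k {y | ∃ w ν, ∃ f ∈ gIdeal Q a w ν, y = stdElt Q red w f ν}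

theorem stdElt_mem_gSpan {w : Equiv.Perm (Fin n)} {ν : Weight D n β} {f : MvPolynomial (Fin n) k}
    (hf : f ∈ gIdeal Q a w ν) : stdElt Q red w f ν ∈ gSpan Q a red :=
  Submodule.subset_span ⟨w, ν, f, hf, rfl⟩

theorem map_mem_gSpan (φ : KLR Q n β →ₗ[k] KLR Q n β)
    (h : ∀ w ν, ∀ f ∈ gIdeal Q a w ν, φ (stdElt Q red w f ν) ∈ gSpan Q a red)
    {y : KLR Q n β} (hy : y ∈ gSpan Q a red) : φ y ∈ gSpan Q a red := by
  have : gSpan Q a red ≤ (gSpan Q a red).comap φ := Submodule.span_le.2 (by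
    rintro _ ⟨w, ν, f, hf, rfl⟩
    exact h w ν f hf)
  exact this hy

variable (hinj : ∀ ν : Weight D n β, Function.Injective ν.1)
  (hred : ∀ w, IsReducedWord (red w) w)
include hinj hred

theorem mul_mem_gSpan_left (r : KLR Q n β) : ∀ {y}, y ∈ gSpan Q a red → r * y ∈ gSpan Q a red := by
  induction r using induction with
  | algebraMap c => intro y hy; rw [← Algebra.smul_def]; exact Submodule.smul_mem _ c hy
  | e μ =>
    refine map_mem_gSpan (LinearMap.mulLeft k _) fun w ν f hf => ?_
    rw [LinearMap.mulLeft_apply]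
    by_cases h : μ = ν.act w
    · rw [h, e_mul_stdElt_self Q hred]; exact stdElt_mem_gSpan hf
    · rw [e_mul_stdElt_ne Q hred _ h]; exact zero_mem _
  | x t =>
    refine map_mem_gSpan (LinearMap.mulLeft k _) fun w ν f hf => ?_
    rw [LinearMap.mulLeft_apply, x_mul_stdElt Q hred hinj]
    exact stdElt_mem_gSpan (Ideal.mul_mem_left _ _ hf)
  | tau l =>
    refine map_mem_gSpan (LinearMap.mulLeft k _) fun w ν f hf => ?_
    rw [LinearMap.mulLeft_apply]
    rcases ascent_or_descent w⁻¹ l with h | h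
    · rw [tau_mul_stdElt_of_lt Q hred hinj h]
      exact stdElt_mem_gSpan (gIdeal_simple_mul_of_lt h hf)
    · rw [tau_mul_stdElt_of_gt Q hred hinj h]
      exact stdElt_mem_gSpan (gIdeal_simple_mul_of_gt hf)
  | add b c hb hc => intro y hy; rw [add_mul]; exact add_mem (hb hy) (hc hy)
  | mul b c hb hc => intro y hy; rw [mul_assoc]; exact hb (hc hy)

theorem mul_mem_gSpan_right (r : KLR Q n β) :
    ∀ {y}, y ∈ gSpan Q a red → y * r ∈ gSpan Q a red := by
  induction r using induction with
  | algebraMap c =>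
    intro y hy
    rw [← Algebra.commutes, ← Algebra.smul_def]
    exact Submodule.smul_mem _ c hy
  | e μ =>
    refine map_mem_gSpan (LinearMap.mulRight k _) fun w ν f hf => ?_
    rw [LinearMap.mulRight_apply]
    by_cases h : ν = μ
    · rw [← h, stdElt_mul_e_self]; exact stdElt_mem_gSpan hf
    · rw [stdElt_mul_e_ne Q _ _ h]; exact zero_mem _
  | x t =>
    refine map_mem_gSpan (LinearMap.mulRight k _) fun w ν f hf => ?_
    rw [LinearMap.mulRight_apply, stdElt_mul_x]
    exact stdElt_mem_gSpan (Ideal.mul_mem_right _ _ hf)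
  | tau l =>
    refine map_mem_gSpan (LinearMap.mulRight k _) fun w ν f hf => ?_
    rw [LinearMap.mulRight_apply]
    rcases ascent_or_descent w l with h | h
    · rw [stdElt_mul_tau_of_lt Q hred hinj h]
      exact stdElt_mem_gSpan (gIdeal_mul_simple_of_lt h hf)
    · rw [stdElt_mul_tau_of_gt Q hred hinj h]
      exact stdElt_mem_gSpan (gIdeal_mul_simple_of_gt hf)
  | add b c hb hc => intro y hy; rw [mul_add]; exact add_mem (hb hy) (hc hy)
  | mul b c hb hc => intro y hy; rw [← mul_assoc]; exact hc (hb hy)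

omit hinj in
theorem cycloElt_eq (t : Fin n) : cycloElt (n := n) Q a β t =
    ∑ ν : Weight D n β, stdElt Q red 1 (Polynomial.aeval (X t) (a.poly (ν.1 t))) ν := by
  rw [cycloElt]
  refine Finset.sum_congr rfl fun ν _ => ?_
  rw [stdElt_one Q hred, ← Polynomial.aeval_algHom_apply, poly_X]

/-- The span is a two-sided ideal, and it contains the generator because the product in `gProd` is
empty at the first position. -/
theorem cycloIdeal_le {y : KLR Q n β} (hy : y ∈ cycloIdeal Q a n β) : y ∈ gSpan Q a red := by
  let J : TwoSidedIdeal (KLR Q n β) := TwoSidedIdeal.mk' {y | y ∈ gSpan Q a red}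
    (gSpan Q a red).zero_mem
    (fun h h' => (gSpan Q a red).add_mem h h') (fun h => (gSpan Q a red).neg_mem h)
    (fun h => mul_mem_gSpan_left hinj hred _ h) (fun h => mul_mem_gSpan_right hinj hred _ h)
  have hJ : cycloIdeal Q a n β ≤ J := TwoSidedIdeal.span_le.2 (by
    rintro _ ⟨t, ht, rfl⟩
    rw [SetLike.mem_coe, TwoSidedIdeal.mem_mk', cycloElt_eq hred]
    refine sum_mem fun ν _ => stdElt_mem_gSpan ?_
    rw [← gProd_zero Q a 1 ν ht]
    exact Ideal.subset_span ⟨t, rfl⟩)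
  exact (TwoSidedIdeal.mem_mk' _ _ _ _ _ _ _).1 (hJ hy)

/-- Right multiplication by `τ_l` turns the element for `w s_l`, `s_l.ν` and position `lo l` into
the one for `w`, ν and `hi l`. The factor `Q` from `τ_l²` appears precisely when the recursion for
`g` asks for it. -/
theorem stdElt_gProd_mem (r : ℕ) (h : r < n) (w : Equiv.Perm (Fin n)) (ν : Weight D n β) :
    stdElt Q red w (gProd Q a w ν ⟨r, h⟩) ν ∈ cycloIdeal Q a n β := by
  induction r generalizing w ν with
  | zero =>
    have hmem : cycloElt Q a β ⟨0, h⟩ ∈ cycloIdeal Q a n β :=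
      TwoSidedIdeal.subset_span ⟨⟨0, h⟩, rfl, rfl⟩
    have := TwoSidedIdeal.mul_mem_right _ _ (e Q ν)
      (TwoSidedIdeal.mul_mem_left _ (tauWord Q (red w)) _ hmem)
    rw [cycloElt_eq hred, mul_assoc, Finset.sum_mul, Finset.sum_eq_single ν
      (fun μ _ hμ => stdElt_mul_e_ne Q _ _ hμ) (by simp), stdElt_mul_e_self, stdElt_one Q hred,
      ← mul_assoc] at this
    rwa [gProd_zero Q a w ν (by rfl)]
  | succ r ih =>
    have hrn : r < n := Nat.lt_of_succ_lt h
    let l : Fin (n - 1) := ⟨r, by omega⟩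
    have hl : (⟨r, hrn⟩ : Fin n) = lo l := rfl
    have hr : (⟨r + 1, h⟩ : Fin n) = hi l := rfl
    have hmem := TwoSidedIdeal.mul_mem_right _ _ (tau Q l)
      (ih hrn (w * simple l) (ν.act (simple l)))
    rw [hl] at hmem
    rw [hr]
    rcases ascent_or_descent w l with hw | hw
    · rw [gProd_hi_of_lt Q a hw, mul_comm]
      rw [stdElt_mul_tau_of_gt Q hred hinj (by simpa using hw)] at hmem
      simpa [Weight.act_apply] using hmem
    · rw [gProd_hi_of_gt Q a hw]
      rw [stdElt_mul_tau_of_lt Q hred hinj (by simpa using hw)] at hmem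
      simpa using hmem

omit hinj hred in
theorem mem_cycloSubmodule {y : KLR Q n β} :
    y ∈ cycloSubmodule Q a n β ↔ y ∈ cycloIdeal Q a n β := by
  rw [cycloSubmodule, Submodule.restrictScalars_mem, TwoSidedIdeal.mem_asIdeal]

theorem cycloSubmodule_eq : cycloSubmodule Q a n β = gSpan Q a red := by
  refine le_antisymm (fun y hy => cycloIdeal_le hinj hred (mem_cycloSubmodule.1 hy))
    (Submodule.span_le.2 ?_)
  rintro _ ⟨w, ν, f, hf, rfl⟩
  obtain ⟨c, rfl⟩ := Ideal.mem_span_range_iff_exists_fun.1 hf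
  change stdMap Q red w ν _ ∈ cycloSubmodule Q a n β
  rw [map_sum]
  refine sum_mem fun r _ => mem_cycloSubmodule.2 ?_
  change stdElt Q red w _ ν ∈ _
  rw [mul_comm, ← stdElt_mul_poly]
  exact TwoSidedIdeal.mul_mem_right _ _ _ (stdElt_gProd_mem hinj hred r.1 r.2 w ν)

end KLR

end CyclotomicIdeal

/-! ### Assembling the two bases. -/

section Bases

/-- Joint independence makes the span of `f₁` meet `J` trivially, so `f₁` stays independent modulo
`J`. -/
theorem exists_bases {k M M' ι₁ ι₂ : Type*} [CommRing k] [AddCommGroup M] [Module k M]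
    [AddCommGroup M'] [Module k M'] (π : M →ₗ[k] M') (hπ : Function.Surjective π)
    (J : Submodule k M) (hJ : LinearMap.ker π = J) (f₁ : ι₁ → M) (f₂ : ι₂ → M)
    (hli : LinearIndependent k (Sum.elim f₁ f₂)) (h₂ : Submodule.span k (Set.range f₂) = J)
    (h₁ : ⊤ ≤ Submodule.span k (Set.range f₁) ⊔ J) :
    (∃ b : Module.Basis ι₁ k M', ∀ i, b i = π (f₁ i)) ∧
      ∃ b : Module.Basis ι₂ k J, ∀ i, (b i : M) = f₂ i := by
  obtain ⟨l₁, l₂, hd⟩ := linearIndependent_sum.1 hli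
  simp only [Sum.elim_comp_inl, Sum.elim_comp_inr, h₂] at l₁ l₂ hd
  constructor
  · have hs : ⊤ ≤ Submodule.span k (Set.range (π ∘ f₁)) := by
      rw [Set.range_comp, Submodule.span_image, ← LinearMap.range_eq_top.2 hπ,
        LinearMap.range_eq_map]
      refine (Submodule.map_mono h₁).trans ?_
      rw [Submodule.map_sup, ← hJ, LinearMap.le_ker_iff_map.1 le_rfl, sup_bot_eq]
    refine ⟨Module.Basis.mk (l₁.map (hJ ▸ hd)) hs, fun i => ?_⟩
    rw [Module.Basis.mk_apply]
    rfl
  · subst h₂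
    exact ⟨Module.Basis.span l₂, fun i => congrArg Subtype.val (Module.Basis.span_apply l₂ i)⟩

variable {I P k : Type*} [AddCommGroup P] [CommRing k] {D : CartanDatum I P}
  {A : ℕ → AddSubgroup k} {L : P} {Q : QMatrix D A} {a : CyclotomicPolys D A L} {n : ℕ} {β : P}
  [Module.Finite ℤ P]

namespace KLR

variable (Q a n β) in
/-- The canonical surjection `R_β → R^Λ_β` as a linear map. -/
noncomputable def toCyclotomicLinear : KLR Q n β →ₗ[k] Cyclotomic Q a n β :=
  { toCyclotomic Q a n β with map_smul' := fun _ _ => rfl }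

theorem toCyclotomicLinear_surjective : Function.Surjective (toCyclotomicLinear Q a n β) :=
  RingCon.mk'_surjective _

theorem ker_toCyclotomicLinear :
    LinearMap.ker (toCyclotomicLinear Q a n β) = cycloSubmodule Q a n β := by
  ext y
  rw [mem_cycloSubmodule, TwoSidedIdeal.mem_iff, LinearMap.mem_ker]
  exact RingCon.eq _

variable {red : Equiv.Perm (Fin n) → List (Fin (n - 1))}

variable (L Q red) in
/-- The elements `τ_w x^c e(ν)` with small exponents. -/
noncomputable def quotientFamily (p : Σ q : Weight D n β × Equiv.Perm (Fin n),
    {c : Fin n → ℕ // ∀ t, c t < natBound L D q.2 q.1 t}) : KLR Q n β :=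
  stdElt Q red p.1.2 (smallMonomial k _ p.2) p.1.1

variable (Q a red) in
/-- The elements `τ_w x^c g^Λ_{w,ν,r} e(ν)` with small exponents. -/
noncomputable def idealFamily (p : Σ q : Weight D n β × Equiv.Perm (Fin n),
    {c : (Fin n → ℕ) × Fin n // ∀ t, c.2 < t → c.1 t < natBound L D q.2 q.1 t}) : KLR Q n β :=
  stdElt Q red p.1.2 (smallMultiple _ (gProd Q a p.1.2 p.1.1) p.2) p.1.1

variable (hinj : ∀ ν : Weight D n β, Function.Injective ν.1)
  (hred : ∀ w, IsReducedWord (red w) w)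
include hinj hred

-- The polynomial families are independent for each pair of ν and `w`; the injective PBW map carries
-- their direct sum into the algebra.
open scoped Classical in
theorem linearIndependent_families :
    LinearIndependent k (Sum.elim (quotientFamily (β := β) L Q red) (idealFamily Q a red)) := by
  have h := (Pi.linearIndependent_single (R := k)
    (fun q : Weight D n β × Equiv.Perm (Fin n) =>
      Sum.elim (smallMonomial k (natBound L D q.2 q.1))
        (smallMultiple (natBound L D q.2 q.1) (gProd Q a q.2 q.1)))
    fun q => linearIndependent_small fun r => (isTop_gProd Q a hinj q.2 q.1 r).1).map'
    (pbwMap Q red) (LinearMap.ker_eq_bot.2 (pbwMap_injective Q hinj hred))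
  refine (linearIndependent_equiv' (Equiv.sigmaSumDistrib _ _).symm (funext ?_)).2 h
  rintro (⟨⟨ν, w⟩, c⟩ | ⟨⟨ν, w⟩, c⟩)
  · exact pbwMap_single Q (ν, w) (smallMonomial k (natBound L D w ν) c)
  · exact pbwMap_single Q (ν, w) (smallMultiple (natBound L D w ν) (gProd Q a w ν) c)

theorem span_idealFamily :
    Submodule.span k (Set.range (idealFamily Q a red)) = cycloSubmodule Q a n β := by
  rw [cycloSubmodule_eq hinj hred]
  refine le_antisymm (Submodule.span_le.2 ?_) (Submodule.span_le.2 ?_)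
  · rintro _ ⟨⟨q, c⟩, rfl⟩
    exact stdElt_mem_gSpan (Ideal.mul_mem_left _ _ (Ideal.subset_span ⟨_, rfl⟩))
  · rintro _ ⟨w, ν, f, hf, rfl⟩
    have hf' : f ∈ (gIdeal Q a w ν).restrictScalars k := hf
    rw [gIdeal, ideal_span_eq fun r => (isTop_gProd Q a hinj w ν r).1] at hf'
    have := Submodule.mem_map_of_mem (f := stdMap Q red w ν) hf'
    rw [Submodule.map_span, ← Set.range_comp] at this
    refine Submodule.span_mono ?_ this
    rintro _ ⟨c, rfl⟩
    exact ⟨⟨(ν, w), c⟩, rfl⟩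

theorem span_quotientFamily :
    ⊤ ≤ Submodule.span k (Set.range (quotientFamily L Q red)) ⊔ cycloSubmodule Q a n β := by
  rw [← span_stdElt Q hred hinj, ← span_idealFamily hinj hred, Submodule.span_le]
  rintro _ ⟨w, f, ν, rfl⟩
  have hf := mem_span_small_sup (fun r => (isTop_gProd Q a hinj w ν r).1) f
  have := Submodule.mem_map_of_mem (f := stdMap Q red w ν) hf
  rw [Submodule.map_sup, Submodule.map_span, Submodule.map_span, ← Set.range_comp,
    ← Set.range_comp] at this
  refine (sup_le_sup (Submodule.span_mono ?_) (Submodule.span_mono ?_) :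
    _ ⊔ _ ≤ (_ : Submodule k (KLR Q n β))) this
  · rintro _ ⟨c, rfl⟩
    exact ⟨⟨(ν, w), c⟩, rfl⟩
  · rintro _ ⟨c, rfl⟩
    exact ⟨⟨(ν, w), c⟩, rfl⟩

end KLR

end Bases
end KLRAlg

namespace KLRAlg.KLR

theorem stdElt_monomial {I P k : Type*} [AddCommGroup P] [CommRing k]
    {D : CartanDatum I P} {A : ℕ → AddSubgroup k} [Module.Finite ℤ P]
    (Q : QMatrix D A) {n : ℕ} {β : P} {red : Equiv.Perm (Fin n) → List (Fin (n - 1))}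
    (w : Equiv.Perm (Fin n)) (c : Fin n → ℕ) (ν : Weight D n β) :
    stdElt Q red w (MvPolynomial.monomial (Finsupp.equivFunOnFinite.symm c) 1) ν =
      tauWord Q (red w) * monom (x Q) c * e Q ν := by
  rw [stdElt, poly_monomial]
  rfl

end KLRAlg.KLR

theorem mainTheorem8 {k I P : Type*} [CommRing k] (A : ℕ → AddSubgroup k) [GradedRing A]
    [AddCommGroup P] [Module.Free ℤ P] [Module.Finite ℤ P]
    (D : KLRAlg.CartanDatum I P) (Q : KLRAlg.QMatrix D A)
    (L : P) (hL : D.IsDominant L) (a : KLRAlg.CyclotomicPolys D A L)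
    (n : ℕ) (β : P) (i : Fin n → I) (hi : Function.Injective i) (hβ : β = ∑ j, D.root (i j))
    (red : Equiv.Perm (Fin n) → List (Fin (n - 1)))
    (hred : ∀ w, KLRAlg.IsReducedWord (red w) w) :
    (∃ b : Module.Basis
        {p : KLRAlg.Weight D n β × Equiv.Perm (Fin n) × (Fin n → ℕ) //
          ∀ t, (p.2.2 t : ℤ) < KLRAlg.bound D L p.2.1 p.1 t}
        k (KLRAlg.KLR.Cyclotomic Q a n β),
      ∀ (ν : KLRAlg.Weight D n β) (w : Equiv.Perm (Fin n)) (c : Fin n → ℕ)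
        (h : ∀ t, (c t : ℤ) < KLRAlg.bound D L w ν t),
        b ⟨(ν, w, c), h⟩ = KLRAlg.KLR.toCyclotomic Q a n β
          (KLRAlg.KLR.tauWord Q (red w) * KLRAlg.monom (KLRAlg.KLR.x Q) c * KLRAlg.KLR.e Q ν)) ∧
    (∃ b : Module.Basis
        {p : KLRAlg.Weight D n β × Equiv.Perm (Fin n) × (Fin n → ℕ) × Fin n //
          ∀ t, p.2.2.2 < t → (p.2.2.1 t : ℤ) < KLRAlg.bound D L p.2.1 p.1 t}
        k (KLRAlg.KLR.cycloSubmodule Q a n β),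
      ∀ (ν : KLRAlg.Weight D n β) (w : Equiv.Perm (Fin n)) (c : Fin n → ℕ) (r : Fin n)
        (h : ∀ t, r < t → (c t : ℤ) < KLRAlg.bound D L w ν t),
        (b ⟨(ν, w, c, r), h⟩ : KLRAlg.KLR Q n β) =
          KLRAlg.KLR.tauWord Q (red w) * KLRAlg.monom (KLRAlg.KLR.x Q) c *
            KLRAlg.evalAt (KLRAlg.KLR.x Q) (KLRAlg.gw Q a w ν r) * KLRAlg.KLR.e Q ν) := by
  have hinj : ∀ ν : KLRAlg.Weight D n β, Function.Injective ν.1 := fun ν => ν.injective hi hβ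
  -- The bounds being nonnegative, the integral conditions on exponents agree with those for
  -- `natBound`; this gives the reindexings below.
  have hN : ∀ (ν : KLRAlg.Weight D n β) w t,
      (KLRAlg.natBound L D w ν t : ℤ) = KLRAlg.bound D L w ν t :=
    fun ν w t => (KLRAlg.isTop_gProd Q a hinj w ν t).2
  obtain ⟨⟨b₁, h₁⟩, b₂, h₂⟩ := KLRAlg.exists_bases _ KLRAlg.KLR.toCyclotomicLinear_surjective _
    KLRAlg.KLR.ker_toCyclotomicLinear _ _ (KLRAlg.KLR.linearIndependent_families hinj hred)
    (KLRAlg.KLR.span_idealFamily (a := a) hinj hred)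
    (KLRAlg.KLR.span_quotientFamily hinj hred)
  refine ⟨⟨b₁.reindex
    { toFun := fun p => ⟨(p.1.1, p.1.2, p.2.1), fun t => by
        rw [← hN]; exact_mod_cast p.2.2 t⟩
      invFun := fun p => ⟨(p.1.1, p.1.2.1), p.1.2.2, fun t => by
        have := p.2 t
        rw [← hN] at this
        exact_mod_cast this⟩
      left_inv := fun _ => rfl
      right_inv := fun _ => rfl }, fun ν w c h => ?_⟩, b₂.reindex
    { toFun := fun p => ⟨(p.1.1, p.1.2, p.2.1.1, p.2.1.2), fun t ht => by
        rw [← hN]; exact_mod_cast p.2.2 t ht⟩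
      invFun := fun p => ⟨(p.1.1, p.1.2.1), (p.1.2.2.1, p.1.2.2.2), fun t ht => by
        have := p.2 t ht
        rw [← hN] at this
        exact_mod_cast this⟩
      left_inv := fun _ => rfl
      right_inv := fun _ => rfl }, fun ν w c r h => ?_⟩
  · rw [Module.Basis.reindex_apply, h₁, ← KLRAlg.KLR.stdElt_monomial]
    rfl
  · rw [Module.Basis.reindex_apply, h₂, KLRAlg.gw_eq_gProd Q a hinj, ← KLRAlg.KLR.poly_eq_evalAt]
    change KLRAlg.KLR.tauWord Q (red w) *
      KLRAlg.KLR.poly Q (MvPolynomial.monomial _ 1 * KLRAlg.gProd Q a w ν r) * _ = _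
    rw [map_mul, KLRAlg.KLR.poly_monomial, ← mul_assoc]
    rfl
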